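/- Let $G$ be a countable group and $\mu$ a probability measure on $G$ with finite entropy $H(\mu)=-\sum_g\mu(g)\log\mu(g)<\infty$. For a measure $\theta$ on $G$ let $\mathbf P_\theta$ be the law on the path space $G^{\mathbb Z_+}$ of $x_n=x_0h_1\cdots h_n$, where $x_0$ has distribution $\theta$ and the increments $h_i$ are independent, $\mu$-distributed and independent of $x_0$. Put $\mathbf P=\mathbf P_{\delta_e}$ and $\mathbf P_m=\mathbf P_\theta$ for $\theta=m$ the counting measure. Let $T$ be the time shift $(x_n)\mapsto(x_{n+1})$. The Poisson boundary of $(G,\mu)$ is the space of ergodic components of $T$ in $(G^{\mathbb Z_+},\mathbf P_m)$: a standard Borel $G$-space $\Gamma$ with a measurable map $\mathrm{bnd}:G^{\mathbb Z_+}\to\Gamma$ that is $\mathbf P_m$-a.e. $G$-equivariant and such that the $\sigma$-algebra of $T$-invariant measurable sets coincides, mod $\mathbf P_m$, with the $\sigma$-algebra of $\mathrm{bnd}$-preimages of measurable subsets of $\Gamma$. It carries the harmonic measure $\nu=\mathrm{bnd}(\mathbf P)$. A $\mu$-boundary is a quotient of $(\Gamma,\nu)$ by a $G$-invariant measurable partition,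 i.e. a standard Borel $G$-space $B$ with a measurable map $q:\Gamma\to B$ satisfying $q(g\gamma)=g\,q(\gamma)$ for every $g\in G$ and $\nu$-a.e. $\gamma$, endowed with the measure $\lambda=q(\nu)$. Put $\Pi=q\circ\mathrm{bnd}$. We say that $(B,\lambda)$ is the Poisson boundary if $q$ is an isomorphism mod $0$ of $(\Gamma,\nu)$ onto $(B,\lambda)$. A gauge on $G$ is an increasing sequence $\mathcal G=(\mathcal G_k)_{k\ge1}$ of subsets exhausting $G$; put $|g|_{\mathcal G}=\min\{k:g\in\mathcal G_k\}$. A family of gauges $\mathcal G^\alpha$ is uniformly temperate if all sets $\mathcal G^\alpha_k$ are finite and $\sup_{\alpha,k}\frac1k\log\operatorname{card}\mathcal G^\alpha_k<\infty$; a single gauge is temperate if the family consisting of it alone is uniformly temperate. Let $(B,\lambda)$ be a $\mu$-boundary. (1) If to $\lambda$-a.e. $b\in B$ one can assign a sequence of uniformly temperate gauges $\mathcal G^n(b)$ such that $\frac1n|x_n|_{\mathcal G^n(\Pi\mathbf x)}\to0$ for $\mathbf P$-a.e. sample path $\mathbf x=(x_n)$, then $(B,\lambda)$ is the Poisson boundary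 of $(G,\mu)$. (2) If there are a temperate gauge $\mathcal G$ and a sequence of measurable maps $\pi_n:B\to G$ such that $\frac1n\bigl|\pi_n(\Pi\mathbf x)^{-1}x_n\bigr|_{\mathcal G}\to0$ for $\mathbf P$-a.e. sample path $\mathbf x=(x_n)$, then $(B,\lambda)$ is the Poisson boundary of $(G,\mu)$. -/

import Mathlib

open MeasureTheory Filter Topology

noncomputable section

namespace RandomWalk

section Gauges

/-- A gauge on `G`: an increasing sequence of subsets `𝒢_k`, `k ≥ 1`, exhausting `G`. -/
structure Gauge (G : Type*) where
  sets : ℕ+ → Set G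
  mono : Monotone sets
  exhausts : ∀ g : G, ∃ k : ℕ+, g ∈ sets k

/-- The gauge function `|g| = min {k ≥ 1 : g ∈ 𝒢_k}`. -/
def Gauge.norm {G : Type*} (𝒢 : Gauge G) (g : G) : ℕ :=
  sInf {k : ℕ | ∃ h : 0 < k, g ∈ 𝒢.sets ⟨k, h⟩}

/-- A family of gauges is uniformly temperate if all gauge sets are finite and
`sup_{α, k} (1 / k) log card 𝒢^α_k < ∞`. -/
def UniformlyTemperate {G ι : Type*} (𝒢 : ι → Gauge G) : Prop :=
  (∀ (a : ι) (k : ℕ+), ((𝒢 a).sets k).Finite) ∧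
    ∃ C : ℝ, ∀ (a : ι) (k : ℕ+), 1 / (k : ℝ) * Real.log (((𝒢 a).sets k).ncard : ℝ) ≤ C

/-- A gauge is temperate if all gauge sets are finite and `sup_k (1 / k) log card 𝒢_k < ∞`. -/
def Gauge.Temperate {G : Type*} (𝒢 : Gauge G) : Prop :=
  (∀ k : ℕ+, (𝒢.sets k).Finite) ∧
    ∃ C : ℝ, ∀ k : ℕ+, 1 / (k : ℝ) * Real.log ((𝒢.sets k).ncard : ℝ) ≤ C

end Gauges

section PathSpace

variable {G : Type*} [Group G] [MeasurableSpace G]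

/-- Finiteness of the entropy `H(μ) = -∑_g μ(g) log μ(g)`. -/
def FiniteEntropy (μ : Measure G) : Prop :=
  Summable fun g : G => Real.negMulLog (μ.real {g})

/-- The sample path `x_n = x_0 h_1 h_2 ⋯ h_n` with starting point `p.1 = x_0` and
increments `p.2 i = h_{i+1}`. -/
def path (p : G × (ℕ → G)) (n : ℕ) : G :=
  p.1 * ((List.range n).map p.2).prod

theorem measurable_path [Countable G] [MeasurableSingletonClass G] :
    Measurable (path : G × (ℕ → G) → ℕ → G) := by
  refine measurable_pi_lambda _ fun n => ?_
  induction n with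
  | zero => simpa [path] using measurable_fst
  | succ n ih =>
    have h : (fun p : G × (ℕ → G) => path p (n + 1)) = fun p => path p n * p.2 n := by
      funext p
      simp [path, List.range_succ, mul_assoc]
    rw [h]
    exact (measurable_of_countable fun q : G × G => q.1 * q.2).comp
      (ih.prodMk ((measurable_pi_apply n).comp measurable_snd))

/-- The measure `𝐏_θ` on the path space: the law of the random walk with initial distribution `θ`
(a measure, not necessarily finite) and independent `μ`-distributed right increments. -/
def pathMeasure (μ : Measure G) [IsProbabilityMeasure μ] (θ : Measure G) : Measure (ℕ → G) :=
  (θ.prod (Measure.infinitePi fun _ : ℕ => μ)).map path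

/-- The measure `𝐏`: the law of the random walk started at the identity. -/
def walk (μ : Measure G) [IsProbabilityMeasure μ] : Measure (ℕ → G) :=
  pathMeasure μ (Measure.dirac 1)

/-- The measure `𝐏_m`, where `m` is the counting measure on `G`. -/
def walkCount (μ : Measure G) [IsProbabilityMeasure μ] : Measure (ℕ → G) :=
  pathMeasure μ Measure.count

/-- The time shift `T` in the path space. -/
def shift (x : ℕ → G) : ℕ → G := fun n => x (n + 1)

end PathSpace

section Boundary

variable {G : Type*} [Group G] [MeasurableSpace G]

/-- `bnd : G^{ℤ₊} → Γ` realizes the `G`-space `Γ` as the space of ergodic components of the time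
shift in `(G^{ℤ₊}, 𝐏_m)`: it is measurable, commutes with the action of `G` (which is
coordinate-wise on paths), and the `σ`-algebra of shift invariant measurable sets coincides mod
`𝐏_m` with the `σ`-algebra of preimages of measurable subsets of `Γ`. -/
structure IsPoissonBoundary (μ : Measure G) [IsProbabilityMeasure μ]
    {Γ : Type*} [MeasurableSpace Γ] [MulAction G Γ] (bnd : (ℕ → G) → Γ) : Prop where
  measurable : Measurable bnd
  equivariant : ∀ g : G, ∀ᵐ x ∂(walkCount μ), bnd (g • x) = g • bnd x
  preimage_invariant : ∀ E : Set Γ, MeasurableSet E →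
    ∃ A : Set (ℕ → G), MeasurableSet[MeasurableSpace.invariants shift] A ∧
      A =ᵐ[walkCount μ] bnd ⁻¹' E
  invariant_preimage : ∀ A : Set (ℕ → G), MeasurableSet[MeasurableSpace.invariants shift] A →
    ∃ E : Set Γ, MeasurableSet E ∧ A =ᵐ[walkCount μ] bnd ⁻¹' E

/-- The harmonic measure `ν = bnd(𝐏)` on the Poisson boundary. -/
def harmonicMeasure (μ : Measure G) [IsProbabilityMeasure μ]
    {Γ : Type*} [MeasurableSpace Γ] (bnd : (ℕ → G) → Γ) : Measure Γ :=
  (walk μ).map bnd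

/-- `quot : Γ → B` is the quotient map of the Poisson boundary `(Γ, ν)` by a `G`-invariant
measurable partition, namely the partition into the fibres of `quot`. The `μ`-boundary is then
`(B, quot(ν))`, and its projection from the path space is `quot ∘ bnd`. -/
structure IsMuBoundary (μ : Measure G) [IsProbabilityMeasure μ]
    {Γ : Type*} [MeasurableSpace Γ] [MulAction G Γ] (bnd : (ℕ → G) → Γ)
    {B : Type*} [MeasurableSpace B] [MulAction G B] (quot : Γ → B) : Prop where
  measurable : Measurable quot
  equivariant : ∀ g : G, ∀ᵐ γ ∂(harmonicMeasure μ bnd), quot (g • γ) = g • quot γ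

/-- `f` is an isomorphism mod 0 of the measure spaces `(X, ν)` and `(Y, ρ)`. -/
def IsIsoModZero {X Y : Type*} [MeasurableSpace X] [MeasurableSpace Y]
    (f : X → Y) (ν : Measure X) (ρ : Measure Y) : Prop :=
  MeasurePreserving f ν ρ ∧
    ∃ f' : Y → X, Measurable f' ∧ (∀ᵐ x ∂ν, f' (f x) = x) ∧ (∀ᵐ y ∂ρ, f (f' y) = y)

end Boundary

section Existence

universe u

/-- The Poisson boundary exists as a standard Borel `G`-space: a path `x` is mapped to the
conditional measures, with respect to the invariant `σ`-algebra, at its translates `g⁻¹ x`. -/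
theorem exists_isPoissonBoundary {G : Type u} [Group G] [Countable G] [MeasurableSpace G]
    [MeasurableSingletonClass G] (μ : Measure G) [IsProbabilityMeasure μ] :
    ∃ (Γ : Type u) (_ : MeasurableSpace Γ) (_ : StandardBorelSpace Γ) (_ : MulAction G Γ)
      (_ : MeasurableConstSMul G Γ) (bnd : (ℕ → G) → Γ), IsPoissonBoundary μ bnd := by
  have hsf : SFinite (walkCount μ) := by
    unfold walkCount pathMeasure; infer_instance
  let ρ := (walkCount μ).toFinite
  have hρ : ae ρ = ae (walkCount μ) := ae_toFinite
  have hle : MeasurableSpace.invariants (shift (G := G)) ≤ MeasurableSpace.pi :=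
    MeasurableSpace.invariants_le _
  let κ := ProbabilityTheory.condExpKernel ρ (MeasurableSpace.invariants (shift (G := G)))
  let e : (ℕ → G) → ℝ := embeddingReal (ℕ → G)
  have he : MeasurableEmbedding e := measurableEmbedding_embeddingReal _
  let bnd : (ℕ → G) → (G → ℚ → ENNReal) := fun x g r => κ (g⁻¹ • x) (e ⁻¹' Set.Iic (r : ℝ))
  have hbndI : Measurable[MeasurableSpace.invariants (shift (G := G))] bnd := by
    refine @measurable_pi_lambda _ _ _ (_) _ _ fun g => @measurable_pi_lambda _ _ _ (_) _ _ fun r => ?_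
    have h1 : Measurable[MeasurableSpace.invariants (shift (G := G))]
        fun x => κ x (e ⁻¹' Set.Iic (r : ℝ)) :=
      ProbabilityTheory.measurable_condExpKernel (he.measurable measurableSet_Iic)
    have h2 : @Measurable _ _ (MeasurableSpace.invariants (shift (G := G)))
        (MeasurableSpace.invariants (shift (G := G))) fun x : ℕ → G => g⁻¹ • x :=
      MeasurableSpace.measurable_invariants_of_semiconj
        (measurable_pi_lambda _ fun n => (measurable_of_countable _).comp (measurable_pi_apply n))
        (fun _ => rfl)
    exact @Measurable.comp _ _ _ (_) (_) _ _ _ h1 h2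
  have hbnd : Measurable bnd := hbndI.mono hle le_rfl
  let act : MulAction G (G → ℚ → ENNReal) := arrowAction
  refine ⟨G → ℚ → ENNReal, inferInstance, inferInstance, act, ⟨fun g => ?_⟩, bnd, hbnd, ?_, ?_, ?_⟩
  · exact measurable_pi_lambda _ fun a => measurable_pi_apply (g⁻¹ • a)
  · intro g
    refine Eventually.of_forall fun x => ?_
    funext a r
    change κ (a⁻¹ • g • x) _ = κ ((g⁻¹ • a)⁻¹ • x) _
    rw [smul_smul]
    simp
  · intro E hE
    exact ⟨bnd ⁻¹' E, hbndI hE, ae_eq_refl _⟩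
  · intro A hA
    have hmeas : ∀ S : Set (ℕ → G), MeasurableSet S →
        Measurable[MeasurableSpace.comap bnd inferInstance] fun x => κ x S := by
      have gen : (MeasurableSpace.pi : MeasurableSpace (ℕ → G)) =
          MeasurableSpace.generateFrom (Set.preimage e '' (⋃ a : ℚ, {Set.Iic (a : ℝ)})) := by
        rw [← he.comap_eq, BorelSpace.measurable_eq (α := ℝ), Real.borel_eq_generateFrom_Iic_rat,
          MeasurableSpace.comap_generateFrom]
      refine fun S hS => MeasurableSpace.induction_on_inter gen
        (Real.isPiSystem_Iic_rat.comap e) ?_ ?_ ?_ ?_ S hS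
      · simp
      · rintro _ ⟨s, hs, rfl⟩
        simp only [Set.mem_iUnion, Set.mem_singleton_iff] at hs
        obtain ⟨r, rfl⟩ := hs
        have : (fun x => κ x (e ⁻¹' Set.Iic (r : ℝ))) =
            (fun γ : G → ℚ → ENNReal => γ 1 r) ∘ bnd := by
          funext x; simp [bnd]
        rw [this]
        exact Measurable.comp ((measurable_pi_apply r).comp (measurable_pi_apply (1 : G)))
          (comap_measurable bnd)
      · intro t ht hm
        have : (fun x => κ x tᶜ) = fun x => 1 - κ x t := by
          funext x; exact prob_compl_eq_one_sub ht
        rw [this]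
        exact measurable_const.sub hm
      · intro f hd hf hm
        have : (fun x => κ x (⋃ i, f i)) = fun x => ∑' i, κ x (f i) := by
          funext x; exact measure_iUnion hd hf
        rw [this]
        exact Measurable.ennreal_tsum hm
    obtain ⟨E, hE, hEA⟩ := hmeas A (hle A hA) (measurableSet_singleton 1)
    refine ⟨E, hE, ?_⟩
    have h1 := ProbabilityTheory.condExpKernel_ae_eq_condExp (μ := ρ) hle (hle A hA)
    rw [condExp_of_stronglyMeasurable hle
      ((stronglyMeasurable_const (b := (1 : ℝ))).indicator hA)
      ((integrable_const (1 : ℝ)).indicator (hle A hA))] at h1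
    rw [EventuallyEq, hρ] at h1
    filter_upwards [h1] with x hx
    rw [hEA]
    refine propext ?_
    change A x ↔ κ x A = 1
    change (κ x A).toReal = _ at hx
    by_cases hxA : x ∈ A
    · rw [Set.indicator_of_mem hxA] at hx
      exact ⟨fun _ => (ENNReal.toReal_eq_one_iff _).1 hx, fun _ => hxA⟩
    · rw [Set.indicator_of_notMem hxA] at hx
      refine ⟨fun h => absurd h hxA, fun h => ?_⟩
      rw [h] at hx
      simp at hx

end Existence

end RandomWalk

end

set_option linter.unusedSectionVars false

/-! The proof is an entropy comparison. Read in terms of the increments, the boundary map becomes a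
map `β` with `β ω = ω 0 • β (shift ω)`. Let ν be its law and φ_g = d(gν)/dν. Given x_n = g, the
limit point has law gν, so by Bayes the probability of x_n = g given β = b is μ^{*n}(g) φ_g(b)
(`IsStationary.condDistrib_pos`). Minus its logarithm along the path is `condInfo`, the difference
of `posInfo` and `logDensity`, and it is nonnegative. The chain rule makes `logDensity` additive
along the shift (`IsStationary.logDensity_succ`), so its mean at time n is n·h, where h is its mean
at time 1.

This applies both to Γ and to its quotient B, with constants h_Γ and h_B. Sublinear growth in
temperate gauges confines x_n, given the point of B, to sets of subexponential size, so `condInfo`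
for B is o(n) in probability. Subadditivity dominates it by a stationary sum, which turns this into
o(n) in mean (`IsStationary.tendsto_integral_condInfo`). Nonnegativity of `condInfo` for Γ then
gives n·h_Γ ≤ E `posInfo` ≤ n·h_B + o(n), hence h_Γ ≤ h_B.

The equality case of log t ≤ t - 1 now forces the densities on Γ to be those of B composed with the
quotient map q. So for bounded f on Γ the function f - E[f | q] integrates to zero against gν for
each g reached by the walk. These integrals are conditional expectations given finitely many
increments, so f = E[f | q] almost everywhere; taking for f an embedding of Γ into ℝ inverts q. The
second criterion is the first one for left translates of a fixed gauge. -/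

namespace RandomWalk

/-! ### Bernoulli shift of increments and positions of the walk -/

section Increments

variable {G : Type*} [Group G] [MeasurableSpace G]

/-- The law of the sequence of increments of the random walk. -/
noncomputable def increments (μ : Measure G) [IsProbabilityMeasure μ] : Measure (ℕ → G) :=
  Measure.infinitePi fun _ : ℕ => μ

instance (μ : Measure G) [IsProbabilityMeasure μ] : IsProbabilityMeasure (increments μ) := by
  unfold increments; infer_instance

/-- The product of the first `n` increments. -/
def pos (n : ℕ) (ω : ℕ → G) : G := ((List.range n).map ω).prod

@[simp] theorem pos_zero (ω : ℕ → G) : pos 0 ω = 1 := by simp [pos]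

theorem pos_succ (n : ℕ) (ω : ℕ → G) : pos (n + 1) ω = pos n ω * ω n := by
  simp [pos, List.range_succ]

theorem pos_succ' (n : ℕ) (ω : ℕ → G) : pos (n + 1) ω = ω 0 * pos n (shift ω) := by
  induction n with
  | zero => simp [pos_succ]
  | succ n ih => rw [pos_succ, ih, pos_succ, mul_assoc]; rfl

@[simp] theorem pos_one (ω : ℕ → G) : pos 1 ω = ω 0 := by simp [pos_succ]

theorem path_one (ω : ℕ → G) : path (1, ω) = fun n => pos n ω := by
  funext n; simp [path, pos]

/-- The sequence whose first `n` terms are those of `p.1`, continued by the terms of `p.2`. -/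
def splice (n : ℕ) (p : (ℕ → G) × (ℕ → G)) : ℕ → G :=
  fun i => if i < n then p.1 i else p.2 (i - n)

theorem measurable_splice (n : ℕ) : Measurable (splice (G := G) n) := by
  refine measurable_pi_lambda _ fun i => ?_
  unfold splice
  by_cases h : i < n
  · simp only [h, if_true]; fun_prop
  · simp only [h, if_false]; fun_prop

theorem measurable_shift : Measurable (shift (G := G)) :=
  measurable_pi_lambda _ fun n => measurable_pi_apply (n + 1)

theorem shift_iterate (n : ℕ) (ω : ℕ → G) : shift^[n] ω = fun i => ω (i + n) := by
  induction n generalizing ω with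
  | zero => rfl
  | succ n ih =>
    rw [Function.iterate_succ_apply, ih]
    funext i
    simp only [shift]
    congr 1

theorem shift_iterate_splice (n : ℕ) (p : (ℕ → G) × (ℕ → G)) :
    shift^[n] (splice n p) = p.2 := by
  rw [shift_iterate]; funext i; simp [splice]

theorem pos_congr {n : ℕ} {ω ω' : ℕ → G} (h : ∀ i < n, ω i = ω' i) : pos n ω = pos n ω' := by
  unfold pos
  congr 1
  exact List.map_congr_left fun i hi => h i (by simpa using hi)

theorem pos_splice (n : ℕ) (p : (ℕ → G) × (ℕ → G)) : pos n (splice n p) = pos n p.1 :=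
  pos_congr fun i hi => by simp [splice, hi]

/-- The first `n` increments and the later ones are independent, and the later ones again form an
i.i.d. sequence. It is checked on finite boxes, and is the form in which independence is used below.
-/
theorem measurePreserving_splice (μ : Measure G) [IsProbabilityMeasure μ] (n : ℕ) :
    MeasurePreserving (splice n) ((increments μ).prod (increments μ)) (increments μ) := by
  refine ⟨measurable_splice n, ?_⟩
  refine Measure.eq_infinitePi (μ := fun _ : ℕ => μ) fun s t ht => ?_
  rw [Measure.map_apply (measurable_splice n)
    (MeasurableSet.pi s.countable_toSet fun i _ => ht i)]
  have : splice n ⁻¹' (Set.pi s t) = (Set.pi (s.filter (· < n) : Finset ℕ) t) ×ˢ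
      (Set.pi ((s.filter (¬ · < n)).image (· - n) : Finset ℕ) fun i => t (i + n)) := by
    ext p
    simp only [splice, Set.mem_preimage, Set.mem_pi, Set.mem_prod, Finset.coe_filter,
      Finset.coe_image, Set.mem_image, Set.mem_ofPred_eq, SetLike.mem_coe]
    constructor
    · intro h
      refine ⟨fun i hi => by simpa [hi.2] using h i hi.1, ?_⟩
      rintro _ ⟨i, hi, rfl⟩
      have := h i hi.1
      rw [if_neg hi.2] at this
      rwa [Nat.sub_add_cancel (not_lt.1 hi.2)]
    · rintro ⟨h1, h2⟩ i hi
      by_cases hin : i < n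
      · simpa [hin] using h1 i ⟨hi, hin⟩
      · have := h2 (i - n) ⟨i, ⟨hi, hin⟩, rfl⟩
        rw [Nat.sub_add_cancel (not_lt.1 hin)] at this
        simpa [hin] using this
  rw [this, Measure.prod_prod, increments, Measure.infinitePi_pi _ fun i _ => ht i,
    Measure.infinitePi_pi _ fun i _ => ht (i + n),
    Finset.prod_image, ← Finset.prod_filter_mul_prod_filter_not s (· < n)]
  · congr 1
    refine Finset.prod_congr rfl fun i hi => ?_
    rw [Nat.sub_add_cancel (not_lt.1 (Finset.mem_filter.1 hi).2)]
  · intro i hi j hj hij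
    have h1 := (Finset.mem_filter.1 hi).2
    have h2 := (Finset.mem_filter.1 hj).2
    simp only at hij
    omega

theorem measurePreserving_shift_iterate (μ : Measure G) [IsProbabilityMeasure μ] (n : ℕ) :
    MeasurePreserving shift^[n] (increments μ) (increments μ) := by
  refine ⟨measurable_shift.iterate n, ?_⟩
  conv_lhs => rw [← (measurePreserving_splice μ n).map_eq]
  rw [Measure.map_map (measurable_shift.iterate n) (measurable_splice n)]
  have : (shift^[n] ∘ splice n : (ℕ → G) × (ℕ → G) → ℕ → G) = Prod.snd :=
    funext fun p => shift_iterate_splice n p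
  rw [this]
  exact measurePreserving_snd.map_eq

theorem measurePreserving_shift (μ : Measure G) [IsProbabilityMeasure μ] :
    MeasurePreserving shift (increments μ) (increments μ) :=
  measurePreserving_shift_iterate μ 1

variable [Countable G] [MeasurableSingletonClass G]

theorem measurable_pos (n : ℕ) : Measurable (pos (G := G) n) := by
  induction n with
  | zero => simp [funext pos_zero]
  | succ n ih =>
    rw [funext (pos_succ n)]
    exact (measurable_of_countable fun q : G × G => q.1 * q.2).comp
      (ih.prodMk (measurable_pi_apply n))

/-- The law of the position of the random walk at time `n`. -/
noncomputable def posLaw (μ : Measure G) [IsProbabilityMeasure μ] (n : ℕ) : Measure G :=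
  (increments μ).map (pos n)

instance (μ : Measure G) [IsProbabilityMeasure μ] (n : ℕ) :
    IsProbabilityMeasure (posLaw μ n) :=
  Measure.isProbabilityMeasure_map (measurable_pos n).aemeasurable

theorem posLaw_one (μ : Measure G) [IsProbabilityMeasure μ] : posLaw μ 1 = μ := by
  rw [posLaw, funext pos_one]
  exact Measure.infinitePi_map_eval _ 0

theorem ae_posLaw_ne_zero (μ : Measure G) [IsProbabilityMeasure μ] (n : ℕ) :
    ∀ᵐ ω ∂increments μ, posLaw μ n {pos n ω} ≠ 0 := by
  have : ∀ᵐ g ∂posLaw μ n, posLaw μ n {g} ≠ 0 := by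
    rw [ae_iff_of_countable]; exact fun g h => h
  exact ae_of_ae_map (measurable_pos n).aemeasurable this

theorem walk_eq_map (μ : Measure G) [IsProbabilityMeasure μ] :
    walk μ = (increments μ).map (fun ω => path (1, ω)) := by
  rw [walk, pathMeasure, Measure.dirac_prod, Measure.map_map measurable_path (by fun_prop)]
  rfl

/-- The probability of the position `g h` is at least that of a first increment `g` followed by `n`
increments with product `h`. -/
theorem posLaw_succ_ge (μ : Measure G) [IsProbabilityMeasure μ] (n : ℕ) (g h : G) :
    μ {g} * posLaw μ n {h} ≤ posLaw μ (n + 1) {g * h} := by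
  rw [posLaw, posLaw, Measure.map_apply (measurable_pos _) (measurableSet_singleton _),
    Measure.map_apply (measurable_pos _) (measurableSet_singleton _),
    ← (measurePreserving_splice μ 1).measure_preimage
      ((measurable_pos (n + 1)) (measurableSet_singleton _)).nullMeasurableSet]
  have h1 : μ {g} = increments μ ((fun ω => ω 0) ⁻¹' {g}) := by
    rw [← Measure.map_apply (measurable_pi_apply 0) (measurableSet_singleton g), increments,
      Measure.infinitePi_map_eval]
  rw [h1, ← Measure.prod_prod]
  refine measure_mono ?_
  rintro ⟨ω, ω'⟩ ⟨h1, h2⟩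
  simp only [Set.mem_preimage, Set.mem_singleton_iff] at h1 h2 ⊢
  have := shift_iterate_splice 1 (ω, ω')
  simp only [Function.iterate_one] at this
  rw [pos_succ', this, h2, ← h1]
  rfl

end Increments

end RandomWalk

namespace RandomWalk

/-! ### Stationary maps and Radon-Nikodym densities of translates -/

section Stationary

open scoped ENNReal

variable {G : Type*} [Group G] [MeasurableSpace G]
variable {X : Type*} [MeasurableSpace X] [MulAction G X]

/-- A measurable function of the increments with values in a `G`-space that is equivariant with
respect to removing the first increment. -/
structure IsStationary (μ : Measure G) [IsProbabilityMeasure μ] (β : (ℕ → G) → X) : Prop where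
  measurable : Measurable β
  ae_eq : ∀ᵐ ω ∂increments μ, β ω = ω 0 • β (shift ω)

/-- The translate by `g` of the law of `β`. -/
noncomputable def translate (μ : Measure G) [IsProbabilityMeasure μ] (β : (ℕ → G) → X) (g : G) :
    Measure X :=
  ((increments μ).map β).map (g • ·)

/-- The Radon-Nikodym derivative of the translate by `g` of the law of `β`. -/
noncomputable def density (μ : Measure G) [IsProbabilityMeasure μ] (β : (ℕ → G) → X) (g : G) :
    X → ℝ≥0∞ :=
  (translate μ β g).rnDeriv ((increments μ).map β)

/-- The logarithm of the density of the translate by the `n`-th position at the limit point. -/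
noncomputable def logDensity (μ : Measure G) [IsProbabilityMeasure μ] (β : (ℕ → G) → X) (n : ℕ)
    (ω : ℕ → G) : ℝ :=
  Real.log (density μ β (pos n ω) (β ω)).toReal

variable {μ : Measure G} [IsProbabilityMeasure μ] {β : (ℕ → G) → X}

theorem measurable_density (g : G) : Measurable (density μ β g) := Measure.measurable_rnDeriv _ _

theorem IsStationary.isProbabilityMeasure_map (hβ : IsStationary μ β) :
    IsProbabilityMeasure ((increments μ).map β) :=
  Measure.isProbabilityMeasure_map hβ.measurable.aemeasurable

theorem IsStationary.isProbabilityMeasure_translate [MeasurableConstSMul G X]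
    (hβ : IsStationary μ β) (g : G) : IsProbabilityMeasure (translate μ β g) :=
  have := hβ.isProbabilityMeasure_map
  Measure.isProbabilityMeasure_map (measurable_const_smul g).aemeasurable

theorem IsStationary.iterate (hβ : IsStationary μ β) (n : ℕ) :
    ∀ᵐ ω ∂increments μ, β ω = pos n ω • β (shift^[n] ω) := by
  induction n with
  | zero => simp
  | succ n ih =>
    filter_upwards [hβ.ae_eq, (measurePreserving_shift μ).quasiMeasurePreserving.ae ih]
      with ω h1 h2
    rw [h1, h2, Function.iterate_succ_apply, pos_succ', mul_smul]

/-- Separates the limit point into two independent ingredients: the position at time `n` and a fresh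
copy of `β`. -/
theorem IsStationary.ae_splice (hβ : IsStationary μ β) (n : ℕ) :
    ∀ᵐ p ∂(increments μ).prod (increments μ), β (splice n p) = pos n p.1 • β p.2 := by
  filter_upwards [(measurePreserving_splice μ n).quasiMeasurePreserving.ae (hβ.iterate n)] with p h
  rw [h, pos_splice, shift_iterate_splice]

variable [Countable G] [MeasurableSingletonClass G]

theorem IsStationary.measurable_comp_pos {α : Type*} [MeasurableSpace α] (hβ : IsStationary μ β)
    (n : ℕ) {F : G → X → α} (hF : ∀ g, Measurable (F g)) :
    Measurable fun ω => F (pos n ω) (β ω) :=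
  (measurable_from_prod_countable_right (f := fun p : G × X => F p.1 p.2) hF).comp
    ((measurable_pos n).prodMk hβ.measurable)

theorem IsStationary.measurable_logDensity (hβ : IsStationary μ β) (n : ℕ) :
    Measurable (logDensity μ β n) :=
  Real.measurable_log.comp (hβ.measurable_comp_pos n measurable_density).ennreal_toReal

variable [MeasurableConstSMul G X]

/-- The joint law of position and limit point, disintegrated over the position: given x_n = g, the
limit point is distributed as the translate of ν by `g`. -/
theorem IsStationary.lintegral_comp_pos (hβ : IsStationary μ β) (n : ℕ) {F : G → X → ℝ≥0∞}
    (hF : ∀ g, Measurable (F g)) :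
    ∫⁻ ω, F (pos n ω) (β ω) ∂increments μ =
      ∑' g, posLaw μ n {g} * ∫⁻ b, F g b ∂translate μ β g := by
  have hF' : Measurable fun p : G × X => F p.1 p.2 := measurable_from_prod_countable_right hF
  have hsm : Measurable fun p : G × X => p.1 • p.2 :=
    measurable_from_prod_countable_right fun g => measurable_const_smul g
  rw [← (measurePreserving_splice μ n).lintegral_comp (hβ.measurable_comp_pos n hF)]
  have h1 : ∫⁻ p, F (pos n (splice n p)) (β (splice n p)) ∂(increments μ).prod (increments μ) =
      ∫⁻ p, F (pos n p.1) (pos n p.1 • β p.2) ∂(increments μ).prod (increments μ) := by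
    refine lintegral_congr_ae ?_
    filter_upwards [hβ.ae_splice n] with p hp
    rw [hp, pos_splice]
  have h2 : Measurable fun p : (ℕ → G) × (ℕ → G) => (pos n p.1, β p.2) :=
    ((measurable_pos n).comp measurable_fst).prodMk (hβ.measurable.comp measurable_snd)
  have h3 : Measurable fun p : (ℕ → G) × (ℕ → G) => F (pos n p.1) (pos n p.1 • β p.2) :=
    hF'.comp (((measurable_pos n).comp measurable_fst).prodMk (hsm.comp h2))
  rw [h1, lintegral_prod _ h3.aemeasurable]
  have h4 : ∀ g, ∫⁻ b, F g b ∂translate μ β g = ∫⁻ ω, F g (g • β ω) ∂increments μ := fun g => by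
    rw [translate, lintegral_map (hF g) (measurable_const_smul g),
      lintegral_map (f := fun b => F g (g • b)) ((hF g).comp (measurable_const_smul g))
        hβ.measurable]
  simp_rw [h4]
  rw [← lintegral_map (f := fun g => ∫⁻ ω, F g (g • β ω) ∂increments μ)
    (measurable_of_countable _) (measurable_pos n), lintegral_countable']
  exact tsum_congr fun g => mul_comm _ _

theorem IsStationary.ae_notMem_iff (hβ : IsStationary μ β) (n : ℕ) {S : G → Set X}
    (hS : ∀ g, MeasurableSet (S g)) :
    (∀ᵐ ω ∂increments μ, β ω ∉ S (pos n ω)) ↔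
      ∀ g, posLaw μ n {g} ≠ 0 → translate μ β g (S g) = 0 := by
  have hm : ∀ g, Measurable ((S g).indicator (1 : X → ℝ≥0∞)) := fun g =>
    measurable_one.indicator (hS g)
  have h := hβ.lintegral_comp_pos n hm
  have h0 : (∀ᵐ ω ∂increments μ, β ω ∉ S (pos n ω)) ↔
      ∫⁻ ω, (S (pos n ω)).indicator 1 (β ω) ∂increments μ = 0 := by
    rw [lintegral_eq_zero_iff (hβ.measurable_comp_pos n hm)]
    refine eventually_congr (Eventually.of_forall fun ω => ?_)
    simp
  rw [h0, h, ENNReal.tsum_eq_zero]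
  refine forall_congr' fun g => ?_
  rw [mul_eq_zero, lintegral_indicator_one (hS g)]
  tauto

/-- One term of the stationarity identity ν = ∑ μ^{*n}(g) gν. It yields both the absolute continuity
of gν and the bound μ^{*n}(g) φ_g ≤ 1. -/
theorem IsStationary.posLaw_mul_translate_le (hβ : IsStationary μ β) (n : ℕ) (g : G) {s : Set X}
    (hs : MeasurableSet s) :
    posLaw μ n {g} * translate μ β g s ≤ (increments μ).map β s := by
  have h := hβ.lintegral_comp_pos n (F := fun _ => s.indicator 1)
    fun _ => measurable_one.indicator hs
  simp only [lintegral_indicator_one hs] at h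
  rw [← lintegral_indicator_one (μ := (increments μ).map β) hs,
    lintegral_map (measurable_one.indicator hs) hβ.measurable, h]
  exact ENNReal.le_tsum g

theorem IsStationary.translate_absolutelyContinuous (hβ : IsStationary μ β) {n : ℕ} {g : G}
    (hg : posLaw μ n {g} ≠ 0) : translate μ β g ≪ (increments μ).map β := by
  refine Measure.AbsolutelyContinuous.mk fun s hs h => ?_
  have := hβ.posLaw_mul_translate_le n g hs
  rw [h, nonpos_iff_eq_zero, mul_eq_zero] at this
  tauto

theorem IsStationary.posLaw_mul_density_le_one (hβ : IsStationary μ β) (n : ℕ) (g : G) :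
    ∀ᵐ b ∂(increments μ).map β, posLaw μ n {g} * density μ β g b ≤ 1 := by
  have := hβ.isProbabilityMeasure_map
  refine ae_le_of_forall_setLIntegral_le_of_sigmaFinite
    (measurable_const.mul (measurable_density g)) fun s hs _ => ?_
  rw [lintegral_const_mul _ (measurable_density g), setLIntegral_one]
  exact (mul_le_mul_right (Measure.setLIntegral_rnDeriv_le s) _).trans
    (hβ.posLaw_mul_translate_le n g hs)

theorem IsStationary.density_mul (hβ : IsStationary μ β) {g h : G}
    (hg : translate μ β g ≪ (increments μ).map β) (hh : translate μ β h ≪ (increments μ).map β) :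
    ∀ᵐ b ∂(increments μ).map β,
      density μ β (g * h) b = density μ β g b * density μ β h (g⁻¹ • b) := by
  have := hβ.isProbabilityMeasure_map
  have := hβ.isProbabilityMeasure_translate
  have hm : Measurable fun b => density μ β h (g⁻¹ • b) :=
    (measurable_density h).comp (measurable_const_smul g⁻¹)
  have hm' : Measurable fun b => density μ β g b * density μ β h (g⁻¹ • b) :=
    (measurable_density g).mul hm
  -- The chain rule d(ghν)/dν = d(gν)/dν · d(ghν)/d(gν), where the last factor is φ_h moved by `g`.
  have key : translate μ β (g * h) = ((increments μ).map β).withDensity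
      fun b => density μ β g b * density μ β h (g⁻¹ • b) := by
    change _ = ((increments μ).map β).withDensity
      (density μ β g * fun b => density μ β h (g⁻¹ • b))
    rw [withDensity_mul _ (measurable_density g) hm]
    unfold density
    rw [Measure.withDensity_rnDeriv_eq _ _ hg]
    have h1 : translate μ β (g * h) = (translate μ β h).map (g • ·) := by
      unfold translate
      rw [Measure.map_map (measurable_const_smul g) (measurable_const_smul h)]
      congr 1
      funext b
      simp [mul_smul]
    refine Measure.ext fun s hs => ?_
    rw [h1, Measure.map_apply (measurable_const_smul g) hs, withDensity_apply _ hs,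
      ← Measure.setLIntegral_rnDeriv hh]
    change _ = ∫⁻ a in s, density μ β h (g⁻¹ • a) ∂((increments μ).map β).map (g • ·)
    rw [setLIntegral_map hs hm (measurable_const_smul g)]
    simp only [inv_smul_smul, density]
  unfold density at key ⊢
  conv_lhs => rw [key]
  exact Measure.rnDeriv_withDensity _ hm'

theorem IsStationary.ae_density_ne_zero (hβ : IsStationary μ β) (n : ℕ) :
    ∀ᵐ ω ∂increments μ, density μ β (pos n ω) (β ω) ≠ 0 := by
  have := hβ.isProbabilityMeasure_map
  have := hβ.isProbabilityMeasure_translate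
  refine (hβ.ae_notMem_iff n (S := fun g => density μ β g ⁻¹' {0})
    fun g => measurable_density g (measurableSet_singleton 0)).2 fun g hg => ?_
  have h := Measure.rnDeriv_pos (hβ.translate_absolutelyContinuous hg)
  refine measure_mono_null (fun b hb => ?_) (ae_iff.1 h)
  simpa [density] using hb

theorem IsStationary.ae_density_ne_top (hβ : IsStationary μ β) (n : ℕ) :
    ∀ᵐ ω ∂increments μ, density μ β (pos n ω) (β ω) ≠ ∞ := by
  have := hβ.isProbabilityMeasure_map
  have := hβ.isProbabilityMeasure_translate
  have h : ∀ᵐ b ∂(increments μ).map β, ∀ g, density μ β g b ≠ ∞ :=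
    ae_all_iff.2 fun g => Measure.rnDeriv_ne_top _ _
  filter_upwards [ae_of_ae_map hβ.measurable.aemeasurable h] with ω hω using hω _

/-- Integrating w/φ_g against gν = φ_g ν cancels the density, up to loss where it is 0 or ∞. With w
= 1 it controls the negative part of `logDensity`; with w the density of a quotient it gives the
Gibbs inequality. -/
theorem IsStationary.lintegral_div_density_le (hβ : IsStationary μ β) (n : ℕ) {w : G → X → ℝ≥0∞}
    (hw : ∀ g, Measurable (w g)) :
    ∫⁻ ω, w (pos n ω) (β ω) / density μ β (pos n ω) (β ω) ∂increments μ ≤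
      ∑' g, posLaw μ n {g} * ∫⁻ b, w g b ∂(increments μ).map β := by
  have := hβ.isProbabilityMeasure_map
  have := hβ.isProbabilityMeasure_translate
  rw [hβ.lintegral_comp_pos n (F := fun g b => w g b / density μ β g b)
    fun g => (hw g).div (measurable_density g)]
  refine ENNReal.tsum_le_tsum fun g => ?_
  by_cases hg : posLaw μ n {g} = 0
  · simp [hg]
  refine mul_le_mul_right ?_ _
  rw [← lintegral_rnDeriv_mul (f := fun b => w g b / density μ β g b) (hβ.translate_absolutelyContinuous hg)
    ((hw g).div (measurable_density g)).aemeasurable]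
  exact lintegral_mono fun b => ENNReal.mul_div_le

/-- Logarithm of the density cocycle at `β ω`: removing the first increment moves `β ω` to `β (shift
ω)`. -/
theorem IsStationary.logDensity_succ (hβ : IsStationary μ β) (n : ℕ) :
    ∀ᵐ ω ∂increments μ,
      logDensity μ β (n + 1) ω = logDensity μ β 1 ω + logDensity μ β n (shift ω) := by
  have h : ∀ᵐ b ∂(increments μ).map β, ∀ g h, posLaw μ 1 {g} ≠ 0 → posLaw μ n {h} ≠ 0 →
      density μ β (g * h) b = density μ β g b * density μ β h (g⁻¹ • b) := by
    rw [ae_all_iff]; intro g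
    rw [ae_all_iff]; intro h
    by_cases hg : posLaw μ 1 {g} = 0
    · simp [hg]
    by_cases hh : posLaw μ n {h} = 0
    · simp [hh]
    filter_upwards [hβ.density_mul (hβ.translate_absolutelyContinuous hg)
      (hβ.translate_absolutelyContinuous hh)] with b hb _ _ using hb
  have hs := (measurePreserving_shift μ).quasiMeasurePreserving
  filter_upwards [hβ.ae_eq, ae_of_ae_map hβ.measurable.aemeasurable h, ae_posLaw_ne_zero μ 1,
    hs.ae (ae_posLaw_ne_zero μ n), hβ.ae_density_ne_zero 1, hβ.ae_density_ne_top 1,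
    hs.ae (hβ.ae_density_ne_zero n), hs.ae (hβ.ae_density_ne_top n)]
    with ω h1 h2 h3 h4 h5 h6 h7 h8
  have h9 := h2 _ _ h3 h4
  rw [pos_one] at h9 h5 h6
  have h10 : (ω 0)⁻¹ • β ω = β (shift ω) := by rw [h1, inv_smul_smul]
  rw [h10] at h9
  unfold logDensity
  rw [pos_one, pos_succ', h9, ENNReal.toReal_mul, Real.log_mul]
  · exact ENNReal.toReal_ne_zero.2 ⟨h5, h6⟩
  · exact ENNReal.toReal_ne_zero.2 ⟨h7, h8⟩

end Stationary

end RandomWalk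

namespace RandomWalk

/-! ### Entropy of positions, unconditional and given the limit point -/

section Information

open scoped ENNReal

variable {G : Type*} [Group G] [MeasurableSpace G]

/-- The information content of the position at time `n`. -/
noncomputable def posInfo (μ : Measure G) [IsProbabilityMeasure μ] (n : ℕ) (ω : ℕ → G) : ℝ :=
  -Real.log ((posLaw μ n).real {pos n ω})

variable [Countable G] [MeasurableSingletonClass G]
variable {μ : Measure G} [IsProbabilityMeasure μ]

theorem measurable_posInfo (n : ℕ) : Measurable (posInfo μ n) :=
  (measurable_of_countable fun g : G => -Real.log ((posLaw μ n).real {g})).comp (measurable_pos n)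

theorem posInfo_nonneg (n : ℕ) (ω : ℕ → G) : 0 ≤ posInfo μ n ω :=
  neg_nonneg.2 (Real.log_nonpos measureReal_nonneg measureReal_le_one)

theorem tsum_posLaw (n : ℕ) : ∑' g, posLaw μ n {g} = 1 := by
  simpa using (lintegral_countable' (μ := posLaw μ n) fun _ => 1).symm

theorem posInfo_zero (ω : ℕ → G) : posInfo μ 0 ω = 0 := by
  have : posLaw μ 0 = Measure.dirac 1 := by
    rw [posLaw, funext pos_zero, Measure.map_const]; simp
  simp [posInfo, this, measureReal_def]

theorem posInfo_succ_le (n : ℕ) :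
    ∀ᵐ ω ∂increments μ, posInfo μ (n + 1) ω ≤ posInfo μ 1 ω + posInfo μ n (shift ω) := by
  filter_upwards [ae_posLaw_ne_zero μ 1,
    (measurePreserving_shift μ).quasiMeasurePreserving.ae (ae_posLaw_ne_zero μ n)] with ω h1 h2
  have h := posLaw_succ_ge μ n (ω 0) (pos n (shift ω))
  unfold posInfo
  rw [pos_succ', pos_one, posLaw_one]
  rw [pos_one, posLaw_one] at h1
  have h3 : (0 : ℝ) < μ.real {ω 0} := ENNReal.toReal_pos h1 (measure_ne_top _ _)
  have h4 : (0 : ℝ) < (posLaw μ n).real {pos n (shift ω)} :=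
    ENNReal.toReal_pos h2 (measure_ne_top _ _)
  have h5 : μ.real {ω 0} * (posLaw μ n).real {pos n (shift ω)} ≤
      (posLaw μ (n + 1)).real {ω 0 * pos n (shift ω)} := by
    simp only [measureReal_def]
    rw [← ENNReal.toReal_mul]
    exact ENNReal.toReal_mono (measure_ne_top _ _) h
  have h6 := Real.log_le_log (mul_pos h3 h4) h5
  rw [Real.log_mul h3.ne' h4.ne'] at h6
  linarith

theorem integrable_posInfo_one (hμ : FiniteEntropy μ) : Integrable (posInfo μ 1) (increments μ) := by
  have h0 : posInfo μ 1 = (fun g : G => -Real.log (μ.real {g})) ∘ pos 1 := by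
    funext ω; simp [posInfo, posLaw_one]
  rw [h0, ← integrable_map_measure (measurable_of_countable _).aestronglyMeasurable
    (measurable_pos 1).aemeasurable]
  change Integrable _ (posLaw μ 1)
  rw [posLaw_one]
  refine ⟨(measurable_of_countable _).aestronglyMeasurable, ?_⟩
  rw [hasFiniteIntegral_iff_norm, lintegral_countable']
  have h1 : ∀ g : G, ENNReal.ofReal ‖-Real.log (μ.real {g})‖ * μ {g} =
      ENNReal.ofReal (Real.negMulLog (μ.real {g})) := fun g => by
    have : 0 ≤ -Real.log (μ.real {g}) :=
      neg_nonneg.2 (Real.log_nonpos measureReal_nonneg measureReal_le_one)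
    rw [Real.norm_of_nonneg this, ← ofReal_measureReal (μ := μ) (s := {g}),
      ← ENNReal.ofReal_mul this, Real.negMulLog]
    congr 1
    ring
  simp_rw [h1]
  exact hμ.tsum_ofReal_lt_top

theorem integrable_posInfo (hμ : FiniteEntropy μ) (n : ℕ) :
    Integrable (posInfo μ n) (increments μ) := by
  induction n with
  | zero => simp [funext posInfo_zero]
  | succ n ih =>
    refine ((integrable_posInfo_one hμ).add
      ((measurePreserving_shift μ).integrable_comp_of_integrable ih)).mono'
      (measurable_posInfo _).aestronglyMeasurable ?_
    filter_upwards [posInfo_succ_le (μ := μ) n] with ω h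
    rwa [Real.norm_of_nonneg (posInfo_nonneg _ _)]

variable {X : Type*} [MeasurableSpace X] [MulAction G X] [MeasurableConstSMul G X]
variable {β : (ℕ → G) → X}

theorem IsStationary.logDensity_zero (hβ : IsStationary μ β) :
    ∀ᵐ ω ∂increments μ, logDensity μ β 0 ω = 0 := by
  have := hβ.isProbabilityMeasure_map
  have h : density μ β 1 =ᵐ[(increments μ).map β] fun _ => 1 := by
    have : translate μ β 1 = (increments μ).map β := by
      simp [translate]
    unfold density
    rw [this]
    exact Measure.rnDeriv_self _
  filter_upwards [ae_of_ae_map hβ.measurable.aemeasurable h] with ω h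
  simp [logDensity, h]

theorem IsStationary.logDensity_le_posInfo (hβ : IsStationary μ β) (n : ℕ) :
    ∀ᵐ ω ∂increments μ, logDensity μ β n ω ≤ posInfo μ n ω := by
  have h : ∀ᵐ b ∂(increments μ).map β, ∀ g, posLaw μ n {g} * density μ β g b ≤ 1 :=
    ae_all_iff.2 fun g => hβ.posLaw_mul_density_le_one n g
  filter_upwards [ae_of_ae_map hβ.measurable.aemeasurable h, ae_posLaw_ne_zero μ n,
    hβ.ae_density_ne_zero n, hβ.ae_density_ne_top n] with ω h1 h2 h3 h4
  have h5 : (0 : ℝ) < (posLaw μ n).real {pos n ω} := ENNReal.toReal_pos h2 (measure_ne_top _ _)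
  have h6 : 0 < (density μ β (pos n ω) (β ω)).toReal := ENNReal.toReal_pos h3 h4
  have h7 : (posLaw μ n).real {pos n ω} * (density μ β (pos n ω) (β ω)).toReal ≤ 1 := by
    rw [measureReal_def, ← ENNReal.toReal_mul]
    exact ENNReal.toReal_le_of_le_ofReal zero_le_one (by simpa using h1 (pos n ω))
  have h8 := Real.log_nonpos (mul_pos h5 h6).le h7
  rw [Real.log_mul h5.ne' h6.ne'] at h8
  unfold logDensity posInfo
  linarith

/-- Above, log φ is bounded by `posInfo`, integrable by finite entropy; below, -log φ ≤ 1/φ - 1, and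
1/φ has integral at most 1. -/
theorem IsStationary.integrable_logDensity_one (hβ : IsStationary μ β) (hμ : FiniteEntropy μ) :
    Integrable (logDensity μ β 1) (increments μ) := by
  have := hβ.isProbabilityMeasure_map
  have h1 : ∫⁻ ω, 1 / density μ β (pos 1 ω) (β ω) ∂increments μ ≠ ∞ := by
    refine ne_top_of_le_ne_top ?_ (hβ.lintegral_div_density_le 1 (w := fun _ _ => 1)
      fun _ => measurable_const)
    simp [tsum_posLaw]
  have h2 : Integrable (fun ω => (1 / density μ β (pos 1 ω) (β ω)).toReal) (increments μ) :=
    integrable_toReal_of_lintegral_ne_top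
      (hβ.measurable_comp_pos 1 fun g => measurable_const.div (measurable_density g)).aemeasurable
      h1
  refine ((integrable_posInfo_one hμ).add h2).mono'
    (hβ.measurable_logDensity 1).aestronglyMeasurable ?_
  filter_upwards [hβ.logDensity_le_posInfo 1, hβ.ae_density_ne_zero 1, hβ.ae_density_ne_top 1]
    with ω h3 h4 h5
  have h6 := posInfo_nonneg (μ := μ) 1 ω
  have h7 : 0 < (density μ β (pos 1 ω) (β ω)).toReal := ENNReal.toReal_pos h4 h5
  have h8 := Real.log_le_sub_one_of_pos (inv_pos.2 h7)
  rw [Real.log_inv] at h8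
  simp only [Pi.add_apply, one_div, ENNReal.toReal_inv, Real.norm_eq_abs]
  have h9 := inv_pos.2 h7
  rw [abs_le]
  unfold logDensity at h3 ⊢
  constructor <;> linarith

theorem IsStationary.integrable_logDensity (hβ : IsStationary μ β) (hμ : FiniteEntropy μ) (n : ℕ) :
    Integrable (logDensity μ β n) (increments μ) ∧
      ∫ ω, logDensity μ β n ω ∂increments μ = n * ∫ ω, logDensity μ β 1 ω ∂increments μ := by
  induction n with
  | zero =>
    refine ⟨(integrable_zero _ _ _).congr (hβ.logDensity_zero.mono fun ω h => h.symm), ?_⟩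
    rw [integral_congr_ae hβ.logDensity_zero]
    simp
  | succ n ih =>
    have hs := measurePreserving_shift μ
    have h1 := hβ.integrable_logDensity_one hμ
    have h2 : Integrable (fun ω => logDensity μ β n (shift ω)) (increments μ) :=
      hs.integrable_comp_of_integrable ih.1
    refine ⟨(h1.add h2).congr ((hβ.logDensity_succ n).mono fun ω h => h.symm), ?_⟩
    have h3 : ∫ ω, logDensity μ β n (shift ω) ∂increments μ =
        ∫ ω, logDensity μ β n ω ∂increments μ := by
      conv_rhs => rw [← hs.map_eq]
      rw [integral_map hs.aemeasurable (hβ.measurable_logDensity n).aestronglyMeasurable]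
    rw [integral_congr_ae (hβ.logDensity_succ n), integral_add h1 h2, h3, ih.2]
    push_cast
    ring

/-- The information content of the position at time `n` conditioned on the limit point. -/
noncomputable def condInfo (μ : Measure G) [IsProbabilityMeasure μ] (β : (ℕ → G) → X) (n : ℕ)
    (ω : ℕ → G) : ℝ :=
  posInfo μ n ω - logDensity μ β n ω

theorem IsStationary.measurable_condInfo (hβ : IsStationary μ β) (n : ℕ) :
    Measurable (condInfo μ β n) :=
  (measurable_posInfo n).sub (hβ.measurable_logDensity n)

theorem IsStationary.integrable_condInfo (hβ : IsStationary μ β) (hμ : FiniteEntropy μ) (n : ℕ) :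
    Integrable (condInfo μ β n) (increments μ) :=
  (integrable_posInfo hμ n).sub (hβ.integrable_logDensity hμ n).1

theorem IsStationary.integral_condInfo (hβ : IsStationary μ β) (hμ : FiniteEntropy μ) (n : ℕ) :
    ∫ ω, condInfo μ β n ω ∂increments μ =
      ∫ ω, posInfo μ n ω ∂increments μ - n * ∫ ω, logDensity μ β 1 ω ∂increments μ := by
  rw [← (hβ.integrable_logDensity hμ n).2]
  exact integral_sub (integrable_posInfo hμ n) (hβ.integrable_logDensity hμ n).1

theorem IsStationary.condInfo_nonneg (hβ : IsStationary μ β) (n : ℕ) :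
    ∀ᵐ ω ∂increments μ, 0 ≤ condInfo μ β n ω :=
  (hβ.logDensity_le_posInfo n).mono fun _ h => sub_nonneg.2 h

theorem IsStationary.condInfo_le_sum (hβ : IsStationary μ β) (n : ℕ) :
    ∀ᵐ ω ∂increments μ,
      condInfo μ β n ω ≤ ∑ i ∈ Finset.range n, condInfo μ β 1 (shift^[i] ω) := by
  induction n with
  | zero =>
    filter_upwards [hβ.logDensity_zero] with ω h
    simp [condInfo, h, posInfo_zero]
  | succ n ih =>
    filter_upwards [hβ.logDensity_succ n, posInfo_succ_le (μ := μ) n,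
      (measurePreserving_shift μ).quasiMeasurePreserving.ae ih] with ω h1 h2 h3
    rw [Finset.sum_range_succ']
    simp only [Function.iterate_succ_apply, Function.iterate_zero, id]
    simp only [condInfo] at h3 ⊢
    linarith

/-- Uniform integrability of `condInfo`/n: it lies below an average of identically distributed
integrable variables, so smallness in probability implies smallness in mean. -/
theorem IsStationary.tendsto_integral_condInfo (hβ : IsStationary μ β) (hμ : FiniteEntropy μ)
    (h : ∀ δ > 0, Tendsto (fun n : ℕ => (increments μ).real {ω | δ * n < condInfo μ β n ω})
      atTop (𝓝 0)) {ε : ℝ} (hε : 0 < ε) :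
    ∀ᶠ n : ℕ in atTop, ∫ ω, condInfo μ β n ω ∂increments μ ≤ ε * n := by
  set Y : (ℕ → G) → ℝ := condInfo μ β 1 with hY
  have hYm : Measurable Y := hβ.measurable_condInfo 1
  have hYi : Integrable Y (increments μ) := hβ.integrable_condInfo hμ 1
  -- The tail of the one-step information above level `K`; its mean vanishes as `K` grows.
  let Z : ℕ → (ℕ → G) → ℝ := fun K => {ω | (K : ℝ) < Y ω}.indicator Y
  have hms : ∀ K : ℕ, MeasurableSet {ω | (K : ℝ) < Y ω} := fun K =>
    measurableSet_lt measurable_const hYm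
  have hZi : ∀ K, Integrable (Z K) (increments μ) := fun K => hYi.indicator (hms K)
  have hZ : Tendsto (fun K => ∫ ω, Z K ω ∂increments μ) atTop (𝓝 0) := by
    rw [← integral_zero (ℕ → G) ℝ (μ := increments μ)]
    refine tendsto_integral_of_dominated_convergence (fun ω => ‖Y ω‖)
      (fun K => (hZi K).aestronglyMeasurable) hYi.norm
      (fun K => Eventually.of_forall fun ω => norm_indicator_le_norm_self _ _)
      (Eventually.of_forall fun ω => ?_)
    obtain ⟨N, hN⟩ := exists_nat_ge (Y ω)
    refine tendsto_const_nhds.congr' ?_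
    filter_upwards [eventually_ge_atTop N] with K hK
    have : ω ∉ {ω | (K : ℝ) < Y ω} := by
      have : (N : ℝ) ≤ K := by exact_mod_cast hK
      simp only [Set.mem_ofPred_eq, not_lt]; linarith
    exact (Set.indicator_of_notMem this _).symm
  obtain ⟨K, hK⟩ := ((tendsto_order.1 hZ).2 (ε / 3) (by positivity)).exists
  have hA := (h (ε / 3) (by positivity)).const_mul (K : ℝ)
  rw [mul_zero] at hA
  filter_upwards [(tendsto_order.1 hA).2 (ε / 3) (by positivity)] with n hn
  set A := {ω | ε / 3 * n < condInfo μ β n ω} with hAdef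
  have hAm : MeasurableSet A := measurableSet_lt measurable_const (hβ.measurable_condInfo n)
  -- Off `A` the first term already suffices; on `A` each one-step summand is at most `K` plus its
  -- tail. The mean thus splits into three contributions, each at most `ε / 3 * n`.
  have hpt : ∀ᵐ ω ∂increments μ, condInfo μ β n ω ≤
      ε / 3 * n + ∑ i ∈ Finset.range n, (A.indicator (fun _ => (K : ℝ)) ω + Z K (shift^[i] ω)) := by
    have h0 : ∀ᵐ ω ∂increments μ, ∀ i, 0 ≤ Y (shift^[i] ω) :=
      ae_all_iff.2 fun i => (measurePreserving_shift_iterate μ i).quasiMeasurePreserving.ae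
        (hβ.condInfo_nonneg 1)
    filter_upwards [h0, hβ.condInfo_le_sum n] with ω h1 h2
    have hZ0 : ∀ i, 0 ≤ Z K (shift^[i] ω) := fun i => by
      by_cases hm : shift^[i] ω ∈ {ω | (K : ℝ) < Y ω}
      · simpa only [Z, Set.indicator_of_mem hm] using h1 i
      · simp only [Z, Set.indicator_of_notMem hm, le_refl]
    by_cases hω : ω ∈ A
    · have : (0 : ℝ) ≤ ε / 3 * n := by positivity
      refine h2.trans (le_add_of_nonneg_of_le this (Finset.sum_le_sum fun i _ => ?_))
      rw [Set.indicator_of_mem hω]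
      by_cases hm : shift^[i] ω ∈ {ω | (K : ℝ) < Y ω}
      · simp only [Z, Set.indicator_of_mem hm]
        have : (0 : ℝ) ≤ K := by positivity
        linarith
      · simp only [Z, Set.indicator_of_notMem hm, add_zero]
        simpa using hm
    · rw [Set.indicator_of_notMem hω]
      have h3 : condInfo μ β n ω ≤ ε / 3 * n := by simpa [hAdef] using hω
      refine h3.trans (le_add_of_nonneg_right (Finset.sum_nonneg fun i _ => ?_))
      rw [zero_add]
      exact hZ0 i
  have hZs : ∀ i, Integrable (fun ω => Z K (shift^[i] ω)) (increments μ) := fun i =>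
    (measurePreserving_shift_iterate μ i).integrable_comp_of_integrable (hZi K)
  have hAi : Integrable (A.indicator fun _ => (K : ℝ)) (increments μ) :=
    (integrable_const _).indicator hAm
  have hAZ : ∀ i, Integrable (fun ω => A.indicator (fun _ => (K : ℝ)) ω + Z K (shift^[i] ω))
      (increments μ) := fun i => hAi.add (hZs i)
  have hbound := integral_mono_ae (hβ.integrable_condInfo hμ n)
    ((integrable_const (ε / 3 * n)).add
      (integrable_finsetSum (Finset.range n) fun i _ => hAZ i)) hpt
  have hZint : ∀ i, ∫ ω, Z K (shift^[i] ω) ∂increments μ = ∫ ω, Z K ω ∂increments μ := fun i => by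
    have hs := measurePreserving_shift_iterate μ i
    conv_rhs => rw [← hs.map_eq]
    rw [integral_map hs.aemeasurable (hYm.indicator (hms K)).aestronglyMeasurable]
  have hcalc : ∫ ω, (ε / 3 * n + ∑ i ∈ Finset.range n,
      (A.indicator (fun _ => (K : ℝ)) ω + Z K (shift^[i] ω))) ∂increments μ =
      ε / 3 * n + n * (K * (increments μ).real A + ∫ ω, Z K ω ∂increments μ) := by
    rw [integral_add (integrable_const _)
      (integrable_finsetSum (Finset.range n) fun i _ => hAZ i),
      integral_finsetSum _ fun i _ => hAZ i]
    simp only [integral_add hAi (hZs _), hZint, integral_indicator_const _ hAm, integral_const,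
      probReal_univ, smul_eq_mul, Finset.sum_const, Finset.card_range, nsmul_eq_mul]
    ring
  have hn0 : (0 : ℝ) ≤ n := by positivity
  refine (hbound.trans_eq hcalc).trans ?_
  nlinarith [mul_le_mul_of_nonneg_left (add_le_add hn.le hK.le) hn0]

end Information

end RandomWalk

namespace RandomWalk

/-! ### Counting in temperate gauges -/

section Gauges

open scoped ENNReal

theorem Gauge.mem_of_norm_le {G : Type*} (𝒢 : Gauge G) {g : G} {k : ℕ+} (h : 𝒢.norm g ≤ k) :
    g ∈ 𝒢.sets k := by
  have hne : {k : ℕ | ∃ h : 0 < k, g ∈ 𝒢.sets ⟨k, h⟩}.Nonempty := by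
    obtain ⟨k, hk⟩ := 𝒢.exhausts g
    exact ⟨k, k.pos, hk⟩
  obtain ⟨h1, h2⟩ := Nat.sInf_mem hne
  exact 𝒢.mono (a := ⟨_, h1⟩) h h2

/-- If a random sequence `x_n` is asymptotically sublinear with respect to uniformly temperate
gauges, then the probability of its value at time `n` is not exponentially small, with probability
tending to one. -/
theorem tendsto_measure_exponentially_small {Ω G : Type*} [MeasurableSpace Ω] [MeasurableSpace G]
    [Countable G] [MeasurableSingletonClass G] (ρ : Measure Ω) [IsProbabilityMeasure ρ]
    {x : ℕ → Ω → G} (hx : ∀ n, Measurable (x n)) {𝒢 : ℕ → Gauge G} (h𝒢 : UniformlyTemperate 𝒢)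
    (hlim : ∀ᵐ ω ∂ρ, Tendsto (fun n : ℕ => 1 / (n : ℝ) * ((𝒢 n).norm (x n ω) : ℝ)) atTop (𝓝 0))
    {δ : ℝ} (hδ : 0 < δ) :
    Tendsto (fun n : ℕ => ρ {ω | ρ (x n ⁻¹' {x n ω}) < ENNReal.ofReal (Real.exp (-(δ * n)))})
      atTop (𝓝 0) := by
  obtain ⟨hfin, C₀, hC₀⟩ := h𝒢
  -- The maximum makes the growth rate positive. With ε = δ/(2C), a gauge set of index at most εn +
  -- 1 has at most exp(δn/2 + C) elements, so its atoms of mass below exp(-δn) have total mass at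
  -- most exp(C - δn/2).
  set C : ℝ := max C₀ 1 with hC
  have hC1 : 1 ≤ C := le_max_right _ _
  have hC0 : 0 < C := by linarith
  set ε : ℝ := δ / (2 * C) with hε
  have hεpos : 0 < ε := by positivity
  let k : ℕ → ℕ+ := fun n => ⟨⌊ε * n⌋₊ + 1, Nat.succ_pos _⟩
  let A : ℕ → Set G := fun n => (𝒢 n).sets (k n)
  have hk : ∀ n, (k n : ℝ) ≤ ε * n + 1 := fun n => by
    have : (0 : ℝ) ≤ ε * n := by positivity
    simpa [k] using Nat.floor_le this
  have hcard : ∀ n, ((A n).ncard : ℝ) ≤ Real.exp (δ / 2 * n + C) := fun n => by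
    -- Gauge sets may be empty, and then the logarithmic bound says nothing about the cardinality.
    rcases Nat.eq_zero_or_pos (A n).ncard with h0 | h0
    · rw [h0]; simpa using (Real.exp_pos _).le
    have h1 : (0 : ℝ) < (A n).ncard := by exact_mod_cast h0
    rw [← Real.log_le_iff_le_exp h1]
    have h2 := (hC₀ n (k n)).trans (le_max_left C₀ 1)
    have hk0 : (0 : ℝ) < k n := by exact_mod_cast (k n).pos
    rw [one_div, inv_mul_le_iff₀ hk0] at h2
    calc Real.log (A n).ncard ≤ k n * C := h2
      _ ≤ (ε * n + 1) * C := by gcongr; exact hk n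
      _ = δ / 2 * n + C := by rw [hε]; field_simp
  have hout : Tendsto (fun n => ρ (x n ⁻¹' (A n)ᶜ)) atTop (𝓝 0) := by
    have := tendsto_measure_of_ae_tendsto_indicator_of_isFiniteMeasure (A := (∅ : Set Ω))
      (As := fun n => x n ⁻¹' (A n)ᶜ) (μ := ρ) atTop MeasurableSet.empty
      (fun n => hx n (Set.to_countable _).measurableSet) ?_
    · simpa using this
    · filter_upwards [hlim] with ω hω
      filter_upwards [(tendsto_order.1 hω).2 ε hεpos, eventually_gt_atTop 0] with n hn hn0
      simp only [Set.mem_preimage, Set.mem_compl_iff, Set.mem_empty_iff_false, iff_false, not_not]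
      refine Gauge.mem_of_norm_le _ ?_
      have hn0' : (0 : ℝ) < n := by exact_mod_cast hn0
      rw [one_div, inv_mul_lt_iff₀ hn0'] at hn
      have : (𝒢 n).norm (x n ω) ≤ ⌊ε * n⌋₊ := Nat.le_floor (by linarith)
      exact this.trans (Nat.le_succ _)
  have hin : ∀ n : ℕ, ρ (x n ⁻¹' {g ∈ A n |
      ρ (x n ⁻¹' {g}) < ENNReal.ofReal (Real.exp (-(δ * n)))}) ≤
      ENNReal.ofReal (Real.exp (C - δ / 2 * n)) := fun n => by
    set S := {g ∈ A n | ρ (x n ⁻¹' {g}) < ENNReal.ofReal (Real.exp (-(δ * n)))} with hS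
    have hAf : (A n).Finite := hfin n (k n)
    have hSA : S ⊆ A n := Set.sep_subset _ _
    have hSf : S.Finite := hAf.subset hSA
    have h1 : x n ⁻¹' S = ⋃ g ∈ hSf.toFinset, x n ⁻¹' {g} := by
      ext ω; simp
    calc ρ (x n ⁻¹' S) ≤ ∑ g ∈ hSf.toFinset, ρ (x n ⁻¹' {g}) := by
          rw [h1]; exact measure_biUnion_finset_le _ _
      _ ≤ ∑ g ∈ hSf.toFinset, ENNReal.ofReal (Real.exp (-(δ * n))) :=
          Finset.sum_le_sum fun g hg => ((hSf.mem_toFinset.1 hg).2).le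
      _ = ENNReal.ofReal (S.ncard * Real.exp (-(δ * n))) := by
          rw [Finset.sum_const, nsmul_eq_mul, Set.ncard_eq_toFinset_card S hSf,
            ENNReal.ofReal_mul (by positivity), ENNReal.ofReal_natCast]
      _ ≤ _ := by
          refine ENNReal.ofReal_le_ofReal ?_
          have h2 : (S.ncard : ℝ) ≤ (A n).ncard := by exact_mod_cast Set.ncard_le_ncard hSA hAf
          calc (S.ncard : ℝ) * Real.exp (-(δ * n))
              ≤ Real.exp (δ / 2 * n + C) * Real.exp (-(δ * n)) := by
                gcongr; exact h2.trans (hcard n)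
            _ = _ := by rw [← Real.exp_add]; congr 1; ring
  have hexp : Tendsto (fun n : ℕ => ENNReal.ofReal (Real.exp (C - δ / 2 * n))) atTop (𝓝 0) := by
    rw [← ENNReal.ofReal_zero]
    refine ENNReal.tendsto_ofReal (Real.tendsto_exp_atBot.comp ?_)
    refine tendsto_atBot_add_const_left _ C (tendsto_neg_atTop_atBot.comp ?_)
    exact tendsto_natCast_atTop_atTop.const_mul_atTop (by positivity)
  have hsum := hout.add hexp
  rw [add_zero] at hsum
  refine tendsto_of_tendsto_of_tendsto_of_le_of_le tendsto_const_nhds hsum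
    (fun n => zero_le) fun n => ?_
  refine (measure_mono fun ω hω => ?_).trans ((measure_union_le _ _).trans
    (add_le_add le_rfl (hin n)))
  by_cases h : x n ω ∈ A n
  · exact Or.inr ⟨h, hω⟩
  · exact Or.inl h

end Gauges

/-! ### Conditioning the walk on its limit point -/

section Conditioning

open scoped ENNReal
open ProbabilityTheory

/-- The conditional law given `f = b` is carried by the fibre of `f` over `b`, so `f ω` may be
replaced by the constant `b`. No measurability of `P` is needed: the exceptional set is enlarged to
a measurable null set of `ω`. -/
theorem ae_ae_condDistrib_id {Ω B : Type*} [MeasurableSpace Ω] [StandardBorelSpace Ω] [Nonempty Ω]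
    [MeasurableSpace B] [StandardBorelSpace B] {ρ : Measure Ω} [IsFiniteMeasure ρ] {f : Ω → B}
    (hf : Measurable f) {P : B → Ω → Prop} (h : ∀ᵐ ω ∂ρ, P (f ω) ω) :
    ∀ᵐ b ∂ρ.map f, ∀ᵐ ω ∂condDistrib id f ρ b, P b ω := by
  obtain ⟨N, hN, hNm, hN0⟩ := exists_measurable_superset_of_null (ae_iff.1 h)
  have h1 : ∀ᵐ p ∂ρ.map (fun ω => (f ω, id ω)), p.2 ∉ N ∧ p.1 = f p.2 := by
    rw [ae_map_iff (hf.prodMk measurable_id).aemeasurable]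
    · filter_upwards [measure_eq_zero_iff_ae_notMem.1 hN0] with ω hω using ⟨hω, rfl⟩
    · exact (measurable_snd hNm.compl).inter
        (measurableSet_eq_fun measurable_fst (hf.comp measurable_snd))
  rw [← compProd_map_condDistrib (aemeasurable_id)] at h1
  filter_upwards [Measure.ae_ae_of_ae_compProd h1] with b hb
  filter_upwards [hb] with ω hω
  obtain ⟨h2, rfl⟩ := hω
  by_contra h3
  exact h2 (hN h3)

variable {G : Type*} [Group G] [MeasurableSpace G] [Countable G] [MeasurableSingletonClass G]
variable {μ : Measure G} [IsProbabilityMeasure μ]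
variable {B : Type*} [MeasurableSpace B] [StandardBorelSpace B] [MulAction G B]
  [MeasurableConstSMul G B] {β : (ℕ → G) → B}

/-- Bayes' formula: both sides, integrated over a set `s` of limit points, give the probability that
x_n = g and the limit point lies in `s`. -/
theorem IsStationary.condDistrib_pos (hβ : IsStationary μ β) :
    ∀ᵐ b ∂(increments μ).map β, ∀ n g,
      condDistrib id β (increments μ) b (pos n ⁻¹' {g}) = posLaw μ n {g} * density μ β g b := by
  have := hβ.isProbabilityMeasure_map
  have := hβ.isProbabilityMeasure_translate
  refine ae_all_iff.2 fun n => ae_all_iff.2 fun g => ?_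
  have hm : MeasurableSet (pos n ⁻¹' {g}) := measurable_pos n (measurableSet_singleton g)
  refine ae_eq_of_forall_setLIntegral_eq_of_sigmaFinite (Kernel.measurable_coe _ hm)
    (measurable_const.mul (measurable_density g)) fun s hs _ => ?_
  rw [setLIntegral_map hs (Kernel.measurable_coe _ hm) hβ.measurable,
    setLIntegral_preimage_condDistrib hβ.measurable aemeasurable_id hm hs,
    lintegral_const_mul _ (measurable_density g)]
  have h := hβ.lintegral_comp_pos n (F := fun a => ({g} : Set G).indicator
    (fun _ => s.indicator (1 : B → ℝ≥0∞)) a) fun a => by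
      by_cases ha : a = g
      · simpa [ha] using measurable_one.indicator hs
      · simpa [ha] using measurable_zero
  rw [tsum_eq_single g] at h
  · simp only [Set.mem_singleton_iff, Set.indicator_of_mem, lintegral_indicator_one hs] at h
    have h2 : increments μ (β ⁻¹' s ∩ id ⁻¹' (pos n ⁻¹' {g})) =
        posLaw μ n {g} * translate μ β g s := by
      rw [← h, Set.preimage_id, ← lintegral_indicator_one ((hβ.measurable hs).inter hm)]
      refine lintegral_congr fun ω => ?_
      by_cases h3 : pos n ω = g <;> by_cases h4 : β ω ∈ s <;> simp [h3, h4]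
    rw [h2]
    by_cases hg : posLaw μ n {g} = 0
    · simp [hg]
    · unfold density
      rw [Measure.setLIntegral_rnDeriv (hβ.translate_absolutelyContinuous hg)]
  · intro a ha
    simp [ha]

/-- For almost every fixed `b` the gauges are deterministic and the counting estimate applies to the
conditional law; dominated convergence then integrates over `b`. -/
theorem IsStationary.tendsto_condInfo_of_gauge (hβ : IsStationary μ β) {𝒢 : B → ℕ → Gauge G}
    (h𝒢 : ∀ᵐ b ∂(increments μ).map β, UniformlyTemperate (𝒢 b))
    (hlim : ∀ᵐ ω ∂increments μ, Tendsto
      (fun n : ℕ => 1 / (n : ℝ) * ((𝒢 (β ω) n).norm (pos n ω) : ℝ)) atTop (𝓝 0))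
    {δ : ℝ} (hδ : 0 < δ) :
    Tendsto (fun n : ℕ => (increments μ).real {ω | δ * n < condInfo μ β n ω}) atTop (𝓝 0) := by
  have := hβ.isProbabilityMeasure_map
  set κ := condDistrib id β (increments μ) with hκ
  let c : ℕ → ℝ≥0∞ := fun n => ENNReal.ofReal (Real.exp (-(δ * n)))
  let S : ℕ → Set (B × (ℕ → G)) := fun n =>
    {p | posLaw μ n {pos n p.2} * density μ β (pos n p.2) p.1 < c n}
  have hS : ∀ n, MeasurableSet (S n) := fun n => by
    refine measurableSet_lt ?_ measurable_const
    have h : ∀ g, Measurable fun b => posLaw μ n {g} * density μ β g b := fun g =>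
      measurable_const.mul (measurable_density g)
    exact (measurable_from_prod_countable_right
      (f := fun p : G × B => posLaw μ n {p.1} * density μ β p.1 p.2) h).comp
      (((measurable_pos n).comp measurable_snd).prodMk measurable_fst)
  have h1 : ∀ᵐ b ∂(increments μ).map β,
      Tendsto (fun n => κ b (Prod.mk b ⁻¹' S n)) atTop (𝓝 0) := by
    filter_upwards [h𝒢, ae_ae_condDistrib_id hβ.measurable (P := fun b ω => Tendsto
      (fun n : ℕ => 1 / (n : ℝ) * ((𝒢 b n).norm (pos n ω) : ℝ)) atTop (𝓝 0)) hlim,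
      hβ.condDistrib_pos] with b hb1 hb2 hb3
    have := tendsto_measure_exponentially_small (κ b) (x := pos) measurable_pos hb1 hb2 hδ
    simp_rw [hκ, hb3] at this
    exact this
  have h2 : Tendsto (fun n => ∫⁻ b, κ b (Prod.mk b ⁻¹' S n) ∂(increments μ).map β) atTop
      (𝓝 0) := by
    have := tendsto_lintegral_of_dominated_convergence (μ := (increments μ).map β)
      (F := fun n b => κ b (Prod.mk b ⁻¹' S n)) (f := fun _ => 0) (fun _ => 1)
      (fun n => Kernel.measurable_kernel_prodMk_left (hS n))
      (fun n => Eventually.of_forall fun b => prob_le_one) (by simp) h1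
    simpa using this
  have h3 : ∀ n, ∫⁻ b, κ b (Prod.mk b ⁻¹' S n) ∂(increments μ).map β =
      increments μ {ω | (β ω, ω) ∈ S n} := fun n => by
    rw [← Measure.compProd_apply (hS n), hκ, compProd_map_condDistrib aemeasurable_id,
      Measure.map_apply (hβ.measurable.prodMk measurable_id) (hS n)]
    rfl
  simp_rw [h3] at h2
  have h4 : ∀ n : ℕ, increments μ {ω | δ * n < condInfo μ β n ω} ≤
      increments μ {ω | (β ω, ω) ∈ S n} := fun n => by
    refine measure_mono_ae ?_
    filter_upwards [ae_posLaw_ne_zero μ n, hβ.ae_density_ne_zero n, hβ.ae_density_ne_top n]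
      with ω h5 h6 h7 (h8 : δ * n < condInfo μ β n ω)
    change posLaw μ n {pos n ω} * density μ β (pos n ω) (β ω) < c n
    have h9 : (0 : ℝ) < (posLaw μ n).real {pos n ω} := ENNReal.toReal_pos h5 (measure_ne_top _ _)
    have h10 : 0 < (density μ β (pos n ω) (β ω)).toReal := ENNReal.toReal_pos h6 h7
    rw [← ENNReal.ofReal_toReal (ENNReal.mul_ne_top (measure_ne_top _ _) h7), ENNReal.toReal_mul,
      ENNReal.ofReal_lt_ofReal_iff (Real.exp_pos _)]
    change (posLaw μ n).real {pos n ω} * _ < _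
    rw [← Real.log_lt_iff_lt_exp (mul_pos h9 h10), Real.log_mul h9.ne' h10.ne']
    simp only [condInfo, posInfo, logDensity] at h8
    linarith
  have h5 := tendsto_of_tendsto_of_tendsto_of_le_of_le tendsto_const_nhds h2
    (fun n => zero_le) h4
  simpa [measureReal_def, Function.comp_def] using (ENNReal.tendsto_toReal ENNReal.zero_ne_top).comp h5

end Conditioning

end RandomWalk

namespace RandomWalk

/-! ### The equality case of the entropy inequality, and uniqueness from translates -/

section Rigidity

open scoped ENNReal

variable {G : Type*} [Group G] [MeasurableSpace G] [Countable G] [MeasurableSingletonClass G]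
variable {μ : Measure G} [IsProbabilityMeasure μ]
variable {X : Type*} [MeasurableSpace X] [MulAction G X] [MeasurableConstSMul G X]
variable {Y : Type*} [MeasurableSpace Y] [MulAction G Y] [MeasurableConstSMul G Y]
variable {β : (ℕ → G) → X} {q : X → Y}

/-- If a quotient of a stationary map has no less mutual information with the first increment,
then the densities coincide. -/
theorem IsStationary.logDensity_one_eq_of_integral_le (hβ : IsStationary μ β)
    (hμ : FiniteEntropy μ) (hq : Measurable q) (hqβ : IsStationary μ (q ∘ β))
    (hle : ∫ ω, logDensity μ β 1 ω ∂increments μ ≤ ∫ ω, logDensity μ (q ∘ β) 1 ω ∂increments μ) :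
    ∀ᵐ ω ∂increments μ, logDensity μ β 1 ω = logDensity μ (q ∘ β) 1 ω := by
  have := hβ.isProbabilityMeasure_map
  have := hqβ.isProbabilityMeasure_map
  have := hqβ.isProbabilityMeasure_translate
  have hwm : ∀ g, Measurable fun b => density μ (q ∘ β) g (q b) := fun g =>
    (measurable_density g).comp hq
  -- The likelihood ratio has mean at most 1, while log `R` has nonnegative mean by `hle`. Hence `R
  -- - 1 - log R`, which is nonnegative, has mean zero, and `R = 1` almost everywhere.
  let R : (ℕ → G) → ℝ≥0∞ := fun ω =>
    density μ (q ∘ β) (pos 1 ω) (q (β ω)) / density μ β (pos 1 ω) (β ω)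
  have hRm : Measurable R := hβ.measurable_comp_pos 1
    (F := fun g b => density μ (q ∘ β) g (q b) / density μ β g b)
    fun g => (hwm g).div (measurable_density g)
  have hR : ∫⁻ ω, R ω ∂increments μ ≤ 1 := by
    refine (hβ.lintegral_div_density_le 1 hwm).trans ?_
    rw [← tsum_posLaw (μ := μ) 1]
    refine ENNReal.tsum_le_tsum fun g => mul_le_of_le_one_right' ?_
    rw [← lintegral_map (measurable_density g) hq, Measure.map_map hq hβ.measurable]
    exact (Measure.lintegral_rnDeriv_le).trans prob_le_one
  have hRi : Integrable (fun ω => (R ω).toReal) (increments μ) :=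
    integrable_toReal_of_lintegral_ne_top hRm.aemeasurable (hR.trans_lt ENNReal.one_lt_top).ne
  have hRint : ∫ ω, (R ω).toReal ∂increments μ ≤ 1 := by
    rw [integral_toReal hRm.aemeasurable
      (ae_lt_top hRm (hR.trans_lt ENNReal.one_lt_top).ne)]
    exact ENNReal.toReal_le_of_le_ofReal zero_le_one (by simpa using hR)
  have hpt : ∀ᵐ ω ∂increments μ, 0 < (R ω).toReal ∧
      Real.log (R ω).toReal = logDensity μ (q ∘ β) 1 ω - logDensity μ β 1 ω := by
    filter_upwards [hβ.ae_density_ne_zero 1, hβ.ae_density_ne_top 1, hqβ.ae_density_ne_zero 1,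
      hqβ.ae_density_ne_top 1] with ω h1 h2 h3 h4
    have h5 := ENNReal.toReal_pos h1 h2
    have h6 := ENNReal.toReal_pos h3 h4
    simp only [R, ENNReal.toReal_div, logDensity]
    exact ⟨div_pos h6 h5, Real.log_div h6.ne' h5.ne'⟩
  have hi1 := (hβ.integrable_logDensity hμ 1).1
  have hi2 := (hqβ.integrable_logDensity hμ 1).1
  have hi3 : Integrable (fun ω => (R ω).toReal - 1) (increments μ) := hRi.sub (integrable_const 1)
  have hi4 : Integrable (fun ω => logDensity μ (q ∘ β) 1 ω - logDensity μ β 1 ω) (increments μ) :=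
    hi2.sub hi1
  have hbound : Integrable (fun ω => (R ω).toReal - 1 -
      (logDensity μ (q ∘ β) 1 ω - logDensity μ β 1 ω)) (increments μ) :=
    hi3.sub hi4
  have hnn : 0 ≤ᵐ[increments μ] fun ω => (R ω).toReal - 1 -
      (logDensity μ (q ∘ β) 1 ω - logDensity μ β 1 ω) := by
    filter_upwards [hpt] with ω h
    rw [← h.2]
    exact sub_nonneg.2 (Real.log_le_sub_one_of_pos h.1)
  have hzero : ∫ ω, ((R ω).toReal - 1 -
      (logDensity μ (q ∘ β) 1 ω - logDensity μ β 1 ω)) ∂increments μ = 0 := by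
    refine le_antisymm ?_ (integral_nonneg_of_ae hnn)
    rw [integral_sub hi3 hi4,
      integral_sub hRi (integrable_const 1), integral_sub hi2 hi1]
    simp only [integral_const, probReal_univ, smul_eq_mul, mul_one]
    linarith
  filter_upwards [(integral_eq_zero_iff_of_nonneg_ae hnn hbound).1 hzero, hpt] with ω h1 h2
  simp only [Pi.zero_apply] at h1
  by_cases hR1 : (R ω).toReal = 1
  · rw [hR1] at h1; linarith
  · have := Real.log_lt_sub_one_of_pos h2.1 hR1
    linarith [h2.2]

theorem IsStationary.logDensity_eq_of_one (hβ : IsStationary μ β)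
    (hqβ : IsStationary μ (q ∘ β))
    (h1 : ∀ᵐ ω ∂increments μ, logDensity μ β 1 ω = logDensity μ (q ∘ β) 1 ω) (n : ℕ) :
    ∀ᵐ ω ∂increments μ, logDensity μ β n ω = logDensity μ (q ∘ β) n ω := by
  induction n with
  | zero =>
    filter_upwards [hβ.logDensity_zero, hqβ.logDensity_zero] with ω h2 h3
    rw [h2, h3]
  | succ n ih =>
    filter_upwards [hβ.logDensity_succ n, hqβ.logDensity_succ n, h1,
      (measurePreserving_shift μ).quasiMeasurePreserving.ae ih] with ω h2 h3 h4 h5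
    rw [h2, h3, h4, h5]

/-- Along the walk the equality is seen only gν-almost everywhere, hence ν-almost everywhere where
the density on `X` is nonzero. Where it vanishes it is trivially the smaller one, and comparing
total masses upgrades the inequality to equality. -/
theorem IsStationary.density_eq_of_logDensity_eq (hβ : IsStationary μ β)
    (hq : Measurable q) (hqβ : IsStationary μ (q ∘ β)) {n : ℕ}
    (h : ∀ᵐ ω ∂increments μ, logDensity μ β n ω = logDensity μ (q ∘ β) n ω) {g : G}
    (hg : posLaw μ n {g} ≠ 0) :
    density μ β g =ᵐ[(increments μ).map β] fun b => density μ (q ∘ β) g (q b) := by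
  have := hβ.isProbabilityMeasure_map
  have := hβ.isProbabilityMeasure_translate
  have := hqβ.isProbabilityMeasure_map
  have := hqβ.isProbabilityMeasure_translate
  have hwm : ∀ g, Measurable fun b => density μ (q ∘ β) g (q b) := fun g =>
    (measurable_density g).comp hq
  have h1 : ∀ᵐ ω ∂increments μ,
      β ω ∉ {b | density μ β (pos n ω) b ≠ density μ (q ∘ β) (pos n ω) (q b)} := by
    filter_upwards [h, hβ.ae_density_ne_zero n, hβ.ae_density_ne_top n, hqβ.ae_density_ne_zero n,
      hqβ.ae_density_ne_top n] with ω h1 h2 h3 h4 h5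
    simp only [ne_eq, not_not]
    have := Real.log_injOn_pos (ENNReal.toReal_pos h2 h3) (ENNReal.toReal_pos h4 h5) h1
    exact (ENNReal.toReal_eq_toReal_iff' h3 h5).1 this
  rw [hβ.ae_notMem_iff n (S := fun g => {b | density μ β g b ≠ density μ (q ∘ β) g (q b)})
    fun g => (measurableSet_eq_fun (measurable_density g) (hwm g)).compl] at h1
  have h2 := h1 g hg
  have hac := hβ.translate_absolutelyContinuous hg
  have h3 : density μ β g ≤ᵐ[(increments μ).map β] fun b => density μ (q ∘ β) g (q b) := by
    rw [← Measure.withDensity_rnDeriv_eq _ _ hac, withDensity_apply_eq_zero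
      (Measure.measurable_rnDeriv _ _), measure_eq_zero_iff_ae_notMem] at h2
    filter_upwards [h2] with b hb
    by_cases h0 : density μ β g b = 0
    · rw [h0]; exact zero_le
    · by_contra hlt
      exact hb ⟨h0, fun h => hlt h.le⟩
  refine ae_eq_of_ae_le_of_lintegral_le h3 ?_ (hwm g).aemeasurable ?_
  · exact ((Measure.lintegral_rnDeriv_le).trans_lt (measure_lt_top _ _)).ne
  · rw [← lintegral_map (measurable_density g) hq, Measure.map_map hq hβ.measurable]
    refine (Measure.lintegral_rnDeriv_le).trans ?_
    unfold density
    rw [Measure.lintegral_rnDeriv hac]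
    simp

/-- A function on the target of a stationary map is determined by its integrals with respect to
the translates of the harmonic measure by the positions of the random walk. -/
theorem IsStationary.ae_eq_zero_of_integral_translate (hβ : IsStationary μ β) {f : X → ℝ}
    (hf : Measurable f) (hfi : Integrable f ((increments μ).map β))
    (h : ∀ n g, posLaw μ n {g} ≠ 0 → ∫ b, f b ∂translate μ β g = 0) :
    f =ᵐ[(increments μ).map β] 0 := by
  have hi : Integrable (fun ω => f (β ω)) (increments μ) :=
    hfi.comp_measurable hβ.measurable
  -- A cylinder depends only on increments before some time `n`. Given these, `β` is the position at
  -- time `n` applied to an independent copy of `β`, so the inner integral is one over a translate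
  -- of ν.
  have hcyl : ∀ A ∈ measurableCylinders fun _ : ℕ => G,
      ∫ ω in A, f (β ω) ∂increments μ = 0 := by
    intro A hA
    have hAm : MeasurableSet A := MeasurableSet.of_mem_measurableCylinders hA
    obtain ⟨s, S, hS, hAS⟩ := (mem_measurableCylinders A).1 hA
    obtain ⟨n, hn⟩ : ∃ n, ∀ i ∈ s, i < n := ⟨s.sup id + 1, fun i hi =>
      Nat.lt_succ_of_le (Finset.le_sup (f := id) hi)⟩
    have hsplice : ∀ p, splice n p ∈ A ↔ p.1 ∈ A := fun p => by
      simp only [hAS, mem_cylinder]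
      have : s.restrict (splice n p) = s.restrict p.1 := by
        funext i
        simp [splice, hn i.1 i.2]
      rw [this]
    have hs := measurePreserving_splice μ n
    have hFi : Integrable (A.indicator fun ω => f (β ω)) (increments μ) := hi.indicator hAm
    rw [← integral_indicator hAm, ← hs.map_eq, integral_map hs.aemeasurable
      (by rw [hs.map_eq]; exact hFi.aestronglyMeasurable)]
    have hcongr : (fun p => A.indicator (fun ω => f (β ω)) (splice n p))
        =ᵐ[(increments μ).prod (increments μ)]
        fun p => A.indicator (fun _ => f (pos n p.1 • β p.2)) p.1 := by
      filter_upwards [hβ.ae_splice n] with p hp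
      by_cases hpA : p.1 ∈ A
      · rw [Set.indicator_of_mem hpA, Set.indicator_of_mem ((hsplice p).2 hpA), hp]
      · rw [Set.indicator_of_notMem hpA, Set.indicator_of_notMem (mt (hsplice p).1 hpA)]
    rw [integral_congr_ae hcongr, integral_prod _
      ((hs.integrable_comp_of_integrable hFi).congr hcongr)]
    refine integral_eq_zero_of_ae ?_
    filter_upwards [ae_posLaw_ne_zero μ n] with ω hω
    by_cases hωA : ω ∈ A
    · simp only [Set.indicator_of_mem hωA]
      have := h n _ hω
      rw [translate, integral_map (measurable_const_smul _).aemeasurable hf.aestronglyMeasurable,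
        integral_map (f := fun b => f (pos n ω • b)) hβ.measurable.aemeasurable
          (hf.comp (measurable_const_smul _)).aestronglyMeasurable] at this
      exact this
    · simp [Set.indicator_of_notMem hωA]
  have hall : ∀ A, MeasurableSet A → ∫ ω in A, f (β ω) ∂increments μ = 0 := by
    have huniv : ∫ ω, f (β ω) ∂increments μ = 0 := by
      rw [← setIntegral_univ]
      exact hcyl _ (univ_mem_measurableCylinders _)
    refine fun A hA => MeasurableSpace.induction_on_inter
      generateFrom_measurableCylinders.symm isPiSystem_measurableCylinders ?_ hcyl ?_ ?_ A hA
    · simp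
    · intro t ht h0
      rw [setIntegral_compl ht hi, huniv, h0, sub_zero]
    · intro t hd ht h0
      rw [integral_iUnion ht hd hi.integrableOn]
      simp [h0]
  have h0 : (fun ω => f (β ω)) =ᵐ[increments μ] 0 :=
    hi.ae_eq_zero_of_forall_setIntegral_eq_zero fun A hA _ => hall A hA
  rw [EventuallyEq, ae_map_iff hβ.measurable.aemeasurable
    (measurableSet_eq_fun hf measurable_zero)]
  exact h0

end Rigidity

end RandomWalk

namespace RandomWalk

/-! ### From equal densities to an isomorphism -/

section Maximality

open scoped ENNReal

variable {G : Type*} [Group G] [MeasurableSpace G] [Countable G] [MeasurableSingletonClass G]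
variable {μ : Measure G} [IsProbabilityMeasure μ]

theorem exists_bounded_measurableEmbedding_real (X : Type*) [MeasurableSpace X]
    [StandardBorelSpace X] : ∃ e : X → ℝ, MeasurableEmbedding e ∧ ∃ c, ∀ x, ‖e x‖ ≤ c := by
  refine ⟨Real.arctan ∘ embeddingReal X,
    (Real.continuous_arctan.measurableEmbedding Real.arctan_injective).comp
      (measurableEmbedding_embeddingReal X), Real.pi / 2, fun x => ?_⟩
  rw [Real.norm_eq_abs, abs_le]
  exact ⟨(Real.neg_pi_div_two_lt_arctan _).le, (Real.arctan_lt_pi_div_two _).le⟩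

/-- A measurable map of standard Borel spaces is an isomorphism mod 0 onto its image measure as
soon as some embedding of the source into the real line factors through it almost everywhere. -/
theorem isIsoModZero_of_ae_eq_comp {X Y : Type*} [MeasurableSpace X] [Nonempty X]
    [MeasurableSpace Y] [StandardBorelSpace Y] {ν : Measure X} {q : X → Y} (hq : Measurable q)
    {e : X → ℝ} (he : MeasurableEmbedding e) {k : Y → ℝ} (hk : Measurable k)
    (h : ∀ᵐ x ∂ν, e x = k (q x)) : IsIsoModZero q ν (ν.map q) := by
  have h1 : ∀ᵐ x ∂ν, he.invFun (k (q x)) = x := by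
    filter_upwards [h] with x hx
    rw [← hx, he.leftInverse_invFun x]
  have hm : Measurable fun y => he.invFun (k y) := he.measurable_invFun.comp hk
  refine ⟨⟨hq, rfl⟩, fun y => he.invFun (k y), hm, h1, ?_⟩
  have hset : MeasurableSet {y | q (he.invFun (k y)) = y} :=
    measurableSet_eq_fun (hq.comp hm) measurable_id
  rw [ae_map_iff hq.aemeasurable hset]
  filter_upwards [h1] with x hx
  simp [hx]

variable {X : Type*} [MeasurableSpace X] [StandardBorelSpace X] [MulAction G X]
  [MeasurableConstSMul G X]
variable {Y : Type*} [mY : MeasurableSpace Y] [StandardBorelSpace Y] [MulAction G Y]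
  [MeasurableConstSMul G Y]
variable {β : (ℕ → G) → X} {q : X → Y}

theorem IsStationary.isIsoModZero_of_density_eq (hβ : IsStationary μ β) (hq : Measurable q)
    (h : ∀ n g, posLaw μ n {g} ≠ 0 →
      density μ β g =ᵐ[(increments μ).map β] fun b => density μ (q ∘ β) g (q b)) :
    IsIsoModZero q ((increments μ).map β) (((increments μ).map β).map q) := by
  have hprob := hβ.isProbabilityMeasure_map
  have := hβ.isProbabilityMeasure_translate
  set ν := (increments μ).map β with hν
  have : Nonempty X := nonempty_of_isProbabilityMeasure ν
  obtain ⟨e, he, c, hc⟩ := exists_bounded_measurableEmbedding_real X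
  have hm : mY.comap q ≤ _ := hq.comap_le
  have hei : Integrable e ν := Integrable.of_bound he.measurable.aestronglyMeasurable c
    (Eventually.of_forall hc)
  have hsm : StronglyMeasurable[mY.comap q] (ν[e|mY.comap q]) := stronglyMeasurable_condExp
  obtain ⟨k, hk, hkq⟩ := hsm.measurable.exists_eq_measurable_comp
  refine isIsoModZero_of_ae_eq_comp hq he hk ?_
  -- Against gν the density factors through `q`, so it can be pulled into the conditional
  -- expectation, and `e` and E[e | q] have the same integral.
  have hzero : (fun x => e x - (ν[e|mY.comap q]) x) =ᵐ[ν] 0 := by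
    refine hβ.ae_eq_zero_of_integral_translate (he.measurable.sub (hsm.mono hm).measurable)
      (hei.sub integrable_condExp) fun n g hg => ?_
    have hac := hβ.translate_absolutelyContinuous hg
    rw [← integral_rnDeriv_smul hac]
    let w : X → ℝ := fun b => (density μ (q ∘ β) g (q b)).toReal
    have hw : StronglyMeasurable[mY.comap q] w := by
      refine Measurable.stronglyMeasurable ?_
      exact ((measurable_density g).ennreal_toReal).comp (comap_measurable q)
    have hφ : (fun b => (density μ β g b).toReal) =ᵐ[ν] w := by
      filter_upwards [h n g hg] with b hb
      simp only [w, hb]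
    have hwi : Integrable w ν := Measure.integrable_toReal_rnDeriv.congr hφ
    have hwe : Integrable (w * e) ν :=
      hwi.mul_bdd (c := c) he.measurable.aestronglyMeasurable (Eventually.of_forall hc)
    have hpull := condExp_mul_of_stronglyMeasurable_left hw hwe hei
    have hwe' : Integrable (w * ν[e|mY.comap q]) ν := integrable_condExp.congr hpull
    have h1 : ∫ b, ((translate μ β g).rnDeriv ((increments μ).map β) b).toReal •
        (e b - (ν[e|mY.comap q]) b) ∂(increments μ).map β = ∫ b, ((w * e) b - (w * ν[e|mY.comap q]) b) ∂ν := by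
      refine integral_congr_ae ?_
      filter_upwards [hφ] with b hb
      change (density μ β g b).toReal • _ = _
      rw [hb]
      simp only [smul_eq_mul, Pi.mul_apply]
      ring
    rw [h1, integral_sub hwe hwe', ← integral_congr_ae hpull, integral_condExp hm, sub_self]
  filter_upwards [hzero] with x hx
  rw [hkq] at hx
  simpa [sub_eq_zero] using hx

/-- A quotient of a stationary map with asymptotically vanishing conditional entropy is an
isomorphism. -/
theorem IsStationary.isIsoModZero_of_gauge (hβ : IsStationary μ β) (hμ : FiniteEntropy μ)
    (hq : Measurable q) (hqβ : IsStationary μ (q ∘ β)) {𝒢 : Y → ℕ → Gauge G}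
    (h𝒢 : ∀ᵐ b ∂(increments μ).map (q ∘ β), UniformlyTemperate (𝒢 b))
    (hlim : ∀ᵐ ω ∂increments μ, Tendsto
      (fun n : ℕ => 1 / (n : ℝ) * ((𝒢 (q (β ω)) n).norm (pos n ω) : ℝ)) atTop (𝓝 0)) :
    IsIsoModZero q ((increments μ).map β) (((increments μ).map β).map q) := by
  have hle : ∫ ω, logDensity μ β 1 ω ∂increments μ ≤
      ∫ ω, logDensity μ (q ∘ β) 1 ω ∂increments μ := by
    -- At one large time, the mean of `posInfo` is at least n·h for the source, and at most n·h for
    -- the quotient plus εn; dividing by n compares the two constants.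
    refine le_of_forall_pos_le_add fun ε hε => ?_
    obtain ⟨n, hn, hn0⟩ := ((hqβ.tendsto_integral_condInfo hμ (fun δ hδ =>
      hqβ.tendsto_condInfo_of_gauge h𝒢 hlim hδ) hε).and (eventually_gt_atTop 0)).exists
    have h1 := integral_nonneg_of_ae (hβ.condInfo_nonneg n)
    rw [hβ.integral_condInfo hμ] at h1
    rw [hqβ.integral_condInfo hμ] at hn
    have hn0' : (0 : ℝ) < n := by exact_mod_cast hn0
    refine le_of_mul_le_mul_left ?_ hn0'
    linarith
  have h1 := hβ.logDensity_one_eq_of_integral_le hμ hq hqβ hle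
  exact hβ.isIsoModZero_of_density_eq hq fun n g hg =>
    hβ.density_eq_of_logDensity_eq hq hqβ (hβ.logDensity_eq_of_one hqβ h1 n) hg

end Maximality

/-! ### Stationarity of the Poisson boundary and of its quotients -/

section Boundary

variable {G : Type*} [Group G] [MeasurableSpace G] [Countable G] [MeasurableSingletonClass G]
variable {μ : Measure G} [IsProbabilityMeasure μ]
variable {Γ : Type*} [MeasurableSpace Γ] [MulAction G Γ] {bnd : (ℕ → G) → Γ}

/-- Counting measure charges every starting point, so a null set for `walkCount μ` is null for the
walk from each `g`. -/
theorem ae_path_of_ae_walkCount {p : (ℕ → G) → Prop} (h : ∀ᵐ x ∂walkCount μ, p x) :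
    ∀ g : G, ∀ᵐ ω ∂increments μ, p (path (g, ω)) := by
  have h1 := Measure.ae_ae_of_ae_prod (ae_of_ae_map measurable_path.aemeasurable h)
  rw [ae_iff_of_countable] at h1
  exact fun g => h1 g (by simp)

theorem path_eq_smul (g : G) (ω : ℕ → G) : path (g, ω) = g • path (1, ω) := by
  funext n; simp [path]

theorem shift_path_one (ω : ℕ → G) : shift (path (1, ω)) = path (ω 0, shift ω) := by
  rw [path_eq_smul (ω 0), path_one, path_one]
  funext n
  simp [shift, pos_succ' n ω]

theorem IsPoissonBoundary.ae_shift [StandardBorelSpace Γ] (h : IsPoissonBoundary μ bnd) :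
    ∀ᵐ ω ∂increments μ, bnd (path (1, ω)) = bnd (path (ω 0, shift ω)) := by
  have he := measurableEmbedding_embeddingReal Γ
  have key : ∀ E : Set Γ, MeasurableSet E → ∀ᵐ ω ∂increments μ,
      (bnd (path (1, ω)) ∈ E ↔ bnd (path (ω 0, shift ω)) ∈ E) := by
    intro E hE
    obtain ⟨A, hA, hAE⟩ := h.preimage_invariant E hE
    have h1 := ae_path_of_ae_walkCount hAE.mem_iff
    -- The shifted path starts at the random point `ω 0`, so the statement is needed for all
    -- starting points simultaneously.
    have h2 := (measurePreserving_shift μ).quasiMeasurePreserving.ae (ae_all_iff.2 h1)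
    filter_upwards [h1 1, h2] with ω h3 h4
    have h5 : path (1, ω) ∈ A ↔ shift (path (1, ω)) ∈ A := by
      conv_lhs => rw [← hA.2]
      rfl
    rw [shift_path_one] at h5
    exact h3.symm.trans (h5.trans (h4 (ω 0)))
  -- Rational half-lines pulled back from ℝ form a countable family separating the points of `Γ`.
  have hall := ae_all_iff.2 fun r : ℚ =>
    key (embeddingReal Γ ⁻¹' Set.Iio (r : ℝ)) (he.measurable measurableSet_Iio)
  filter_upwards [hall] with ω hω
  refine he.injective (le_antisymm ?_ ?_)
  · refine le_of_forall_rat_lt_imp_le ?_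
    intro r hr
    by_contra hlt
    exact lt_asymm hr ((hω r).2 (not_le.1 hlt))
  · refine le_of_forall_rat_lt_imp_le ?_
    intro r hr
    by_contra hlt
    exact lt_asymm hr ((hω r).1 (not_le.1 hlt))

theorem IsPoissonBoundary.isStationary [StandardBorelSpace Γ] (h : IsPoissonBoundary μ bnd) :
    IsStationary μ fun ω => bnd (path (1, ω)) := by
  refine ⟨h.measurable.comp (measurable_path.comp (by fun_prop)), ?_⟩
  have h1 := ae_all_iff.2 fun g : G => ae_path_of_ae_walkCount (h.equivariant g) 1
  filter_upwards [h.ae_shift, (measurePreserving_shift μ).quasiMeasurePreserving.ae h1]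
    with ω h2 h3
  rw [h2, path_eq_smul, h3]

theorem IsPoissonBoundary.harmonicMeasure_eq (h : IsPoissonBoundary μ bnd) :
    harmonicMeasure μ bnd = (increments μ).map fun ω => bnd (path (1, ω)) := by
  have hpath : Measurable fun ω : ℕ → G => path (1, ω) := measurable_path.comp (by fun_prop)
  rw [harmonicMeasure, walk_eq_map, Measure.map_map h.measurable hpath]
  rfl

theorem IsMuBoundary.isStationary [StandardBorelSpace Γ] {B : Type*} [MeasurableSpace B]
    [MulAction G B] {quot : Γ → B} (hquot : IsMuBoundary μ bnd quot)
    (h : IsPoissonBoundary μ bnd) :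
    IsStationary μ (quot ∘ fun ω => bnd (path (1, ω))) := by
  have hβ := h.isStationary
  refine ⟨hquot.measurable.comp hβ.measurable, ?_⟩
  have h1 := ae_all_iff.2 hquot.equivariant
  rw [h.harmonicMeasure_eq] at h1
  filter_upwards [hβ.ae_eq, (measurePreserving_shift μ).quasiMeasurePreserving.ae
    (ae_of_ae_map hβ.measurable.aemeasurable h1)] with ω h2 h3
  simp only [Function.comp_apply]
  rw [h2, h3]

end Boundary

/-! ### Reduction of the second criterion to the first -/

section TranslatedGauge

/-- The left translate of a gauge. -/
def Gauge.translate {G : Type*} [Group G] (a : G) (𝒢 : Gauge G) : Gauge G where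
  sets k := {g | a⁻¹ * g ∈ 𝒢.sets k}
  mono _ _ h _ hg := 𝒢.mono h hg
  exhausts g := 𝒢.exhausts (a⁻¹ * g)

theorem Gauge.norm_translate {G : Type*} [Group G] (a : G) (𝒢 : Gauge G) (g : G) :
    (𝒢.translate a).norm g = 𝒢.norm (a⁻¹ * g) := rfl

/-- Left translation preserves cardinalities, so a single growth constant serves all translates. -/
theorem Gauge.Temperate.uniformlyTemperate_translate {G ι : Type*} [Group G] {𝒢 : Gauge G}
    (h : 𝒢.Temperate) (a : ι → G) : UniformlyTemperate fun i => 𝒢.translate (a i) := by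
  have himg : ∀ i k, (𝒢.translate (a i)).sets k = (fun g => a i * g) '' 𝒢.sets k := by
    intro i k
    ext g
    simp only [Gauge.translate, Set.mem_image]
    exact ⟨fun hg => ⟨_, hg, by simp⟩, by rintro ⟨g, hg, rfl⟩; simpa using hg⟩
  obtain ⟨h1, C, h2⟩ := h
  refine ⟨fun i k => ?_, C, fun i k => ?_⟩
  · rw [himg]; exact (h1 k).image _
  · rw [himg, Set.ncard_image_of_injective _ (mul_right_injective _)]
    exact h2 k

end TranslatedGauge

end RandomWalk

open RandomWalk in
theorem theorem5p5 {G : Type*} [Group G] [Countable G] [MeasurableSpace G]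
    [MeasurableSingletonClass G] (μ : Measure G) [IsProbabilityMeasure μ] (hμ : FiniteEntropy μ)
    {Γ : Type*} [MeasurableSpace Γ] [StandardBorelSpace Γ] [MulAction G Γ]
    [MeasurableConstSMul G Γ] (bnd : (ℕ → G) → Γ) (hbnd : IsPoissonBoundary μ bnd)
    {B : Type*} [MeasurableSpace B] [StandardBorelSpace B] [MulAction G B]
    [MeasurableConstSMul G B] (quot : Γ → B) (hquot : IsMuBoundary μ bnd quot) :
    (∀ 𝒢 : B → ℕ → Gauge G,
      (∀ᵐ b ∂((harmonicMeasure μ bnd).map quot), UniformlyTemperate (𝒢 b)) →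
      (∀ᵐ x ∂(walk μ), Tendsto (fun n : ℕ => 1 / (n : ℝ) * ((𝒢 (quot (bnd x)) n).norm (x n) : ℝ))
        atTop (𝓝 0)) →
      IsIsoModZero quot (harmonicMeasure μ bnd) ((harmonicMeasure μ bnd).map quot)) ∧
    (∀ 𝒢 : Gauge G, 𝒢.Temperate →
      ∀ π : ℕ → B → G, (∀ n, Measurable (π n)) →
      (∀ᵐ x ∂(walk μ), Tendsto
        (fun n : ℕ => 1 / (n : ℝ) * (𝒢.norm ((π n (quot (bnd x)))⁻¹ * x n) : ℝ)) atTop (𝓝 0)) →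
      IsIsoModZero quot (harmonicMeasure μ bnd) ((harmonicMeasure μ bnd).map quot)) := by
  have hβ := hbnd.isStationary
  have hqβ := hquot.isStationary hbnd
  have hmap : ((increments μ).map fun ω => bnd (path (1, ω))).map quot =
      (increments μ).map (quot ∘ fun ω => bnd (path (1, ω))) :=
    Measure.map_map hquot.measurable hβ.measurable
  rw [hbnd.harmonicMeasure_eq, walk_eq_map]
  have hpath : Measurable fun ω : ℕ → G => path (1, ω) := measurable_path.comp (by fun_prop)
  constructor
  · intro 𝒢 h𝒢 hlim
    rw [hmap] at h𝒢
    refine hβ.isIsoModZero_of_gauge hμ hquot.measurable hqβ h𝒢 ?_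
    filter_upwards [ae_of_ae_map hpath.aemeasurable hlim] with ω hω
    simpa only [path_one] using hω
  · intro 𝒢 h𝒢 π _ hlim
    refine hβ.isIsoModZero_of_gauge hμ hquot.measurable hqβ
      (𝒢 := fun b n => 𝒢.translate (π n b))
      (Eventually.of_forall fun b => h𝒢.uniformlyTemperate_translate fun n => π n b) ?_
    filter_upwards [ae_of_ae_map hpath.aemeasurable hlim] with ω hω
    simpa only [path_one, Gauge.norm_translate] using hω
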